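/- **Theorem (fermionic and bosonic duality).** Let $N\ge 1$ and $d$ be natural numbers, $\varepsilon>0$, and let $\mathfrak h=(\mathbb C^d)^{\otimes N}$. Let $\Pi_+$ and $\Pi_-$ be the orthogonal projections of $\mathfrak h$ onto the symmetric subspace $\mathfrak h_+=\bigodot_{i=1}^N\mathbb C^d$ and the antisymmetric subspace $\mathfrak h_-=\bigwedge_{i=1}^N\mathbb C^d$. For an operator $A$ on $\mathfrak h$ put $A_\pm:=\Pi_\pm A\,\Pi_\pm$, regarded as an operator on $\mathfrak h_\pm$; in particular $\exp(A_\pm)$ and its trace are taken on $\mathfrak h_\pm$. Operators on $\mathfrak h_\pm$ are identified with operators on $\mathfrak h$ through extension by zero. A density matrix is a positive semidefinite operator of trace one. For a density matrix $\Gamma$ on $\mathfrak h_\pm$ write $\Gamma\mapsto\gamma$ if all its one-particle marginals equal $\gamma$, i.e. $\operatorname{Tr}(\gamma A)=\operatorname{Tr}\big(\Gamma\,(1\otimes\dots\otimes A\otimes\dots\otimes 1)\big)$ for every operator $A$ on $\mathbb C^d$ and every position $i\in\{1,\dots,N\}$ of $A$. For Hermitian $U$ on $\mathbb C^d$ let $\bigoplus_{i=1}^N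 U=\sum_{i=1}^N 1\otimes\dots\otimes \underbrace{U}_{i}\otimes\dots\otimes 1$. Let $H$ be a Hermitian operator on $\mathfrak h$ that is invariant under all permutations of the $N$ tensor factors. For a density matrix $\gamma$ on $\mathbb C^d$ define (with $0\log 0=0$) $$\mathfrak F^\varepsilon_\pm(\gamma)=\inf\{\operatorname{Tr}(H\Gamma)+\varepsilon\operatorname{Tr}(\Gamma\log\Gamma)\;:\;\Gamma\text{ a density matrix on }\mathfrak h_\pm,\ \Gamma\mapsto\gamma\},$$ $$D^{\pm,\varepsilon}_\gamma(U)=\operatorname{Tr}(U\gamma)-\varepsilon\operatorname{Tr}\exp\Big(\tfrac1\varepsilon\Big[\tfrac1N\bigoplus_{i=1}^N U-H\Big]_\pm\Big)+\varepsilon,\qquad \mathfrak D^\varepsilon_\pm(\gamma)=\sup\{D^{\pm,\varepsilon}_\gamma(U): U\text{ Hermitian on }\mathbb C^d\}.$$ (i) *Fermions.* Let $\gamma$ be a density matrix on $\mathbb C^d$ with $\gamma\le\frac1N$ (which forces $N\le d$). Then $\mathfrak F^\varepsilon_-(\gamma)=\mathfrak D^\varepsilon_-(\gamma)$, and this value is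 finite. If moreover $0<\gamma<\frac1N$ (the strict Pauli principle), then $D^{-,\varepsilon}_\gamma$ has a unique Hermitian maximiser $U^\varepsilon_-$, and $$\Gamma^\varepsilon_-=\exp\Big(\tfrac1\varepsilon\Big[\tfrac1N\bigoplus_{i=1}^N U^\varepsilon_--H\Big]_-\Big)$$ is the unique minimiser in the problem defining $\mathfrak F^\varepsilon_-(\gamma)$. (ii) *Bosons.* For every density matrix $\gamma$ on $\mathbb C^d$, $\mathfrak F^\varepsilon_+(\gamma)=\mathfrak D^\varepsilon_+(\gamma)$, and this value is finite. If moreover $\gamma>0$, then $D^{+,\varepsilon}_\gamma$ has a unique Hermitian maximiser $U^\varepsilon_+$, and $$\Gamma^\varepsilon_+=\exp\Big(\tfrac1\varepsilon\Big[\tfrac1N\bigoplus_{i=1}^N U^\varepsilon_+-H\Big]_+\Big)$$ is the unique minimiser in the problem defining $\mathfrak F^\varepsilon_+(\gamma)$. -/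

import Mathlib

open scoped ComplexOrder

namespace QuantumOT

/-- Complex `d × d` matrices: the operators on the one-particle space `ℂ^d`. -/
abbrev OneBody (d : ℕ) := Matrix (Fin d) (Fin d) ℂ

/-- Operators on the `N`-fold tensor product `ℂ^d ⊗ ⋯ ⊗ ℂ^d`, as matrices in the product basis
`e_{x 0} ⊗ ⋯ ⊗ e_{x (N-1)}`, where `x : Fin N → Fin d`. -/
abbrev ManyBody (N d : ℕ) := Matrix (Fin N → Fin d) (Fin N → Fin d) ℂ

/-- The particle statistics: bosons (sign `+`) or fermions (sign `-`). -/
inductive Statistics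
  | boson
  | fermion

/-- The character of the permutation group: trivial for bosons, the signature for fermions. -/
def Statistics.character (s : Statistics) {N : ℕ} (σ : Equiv.Perm (Fin N)) : ℂ :=
  match s with
  | .boson => 1
  | .fermion => ((Equiv.Perm.sign σ : ℤ) : ℂ)

/-- Density matrices: positive semidefinite with trace one. -/
def IsDensity {ι : Type*} [Fintype ι] (A : Matrix ι ι ℂ) : Prop :=
  A.PosSemidef ∧ A.trace = 1

/-- `1 ⊗ ⋯ ⊗ 1 ⊗ A ⊗ 1 ⊗ ⋯ ⊗ 1`, with `A` in position `i`. -/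
def siteOp {N d : ℕ} (i : Fin N) (A : OneBody d) : ManyBody N d :=
  Matrix.of fun x y => A (x i) (y i) * ∏ j ∈ Finset.univ.erase i, if x j = y j then 1 else 0

/-- The Kronecker sum `U ⊕ ⋯ ⊕ U` of `N` copies of `U`. -/
def kroneckerSum (N : ℕ) {d : ℕ} (U : OneBody d) : ManyBody N d :=
  ∑ i : Fin N, siteOp i U

/-- `Γ ↦ γ`: every marginal (partial trace) of `Γ` equals `γ`. -/
def HasMarginals {N d : ℕ} (Γ : ManyBody N d) (γ : OneBody d) : Prop :=
  ∀ (i : Fin N) (A : OneBody d), (γ * A).trace = (Γ * siteOp i A).trace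

/-- Invariance under every permutation of the tensor factors: `H.submatrix (· ∘ σ) (· ∘ σ)` is the
image of `H` under the linear map that sends `⊗ⱼ Aⱼ` to `⊗ⱼ A_{σ⁻¹ j}`. -/
def IsPermSymmetric {N d : ℕ} (H : ManyBody N d) : Prop :=
  ∀ σ : Equiv.Perm (Fin N), H.submatrix (fun x => x ∘ σ) (fun x => x ∘ σ) = H

/-- The projection `Π_±` of the tensor product onto its symmetric / antisymmetric subspace:
`(1 / N!) ∑_σ χ(σ) P_σ`, where `(P_σ ψ) x = ψ (x ∘ σ)`. -/
noncomputable def symProj (s : Statistics) (N d : ℕ) : ManyBody N d :=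
  Matrix.of fun x y =>
    ((N.factorial : ℂ))⁻¹ * ∑ σ : Equiv.Perm (Fin N), if x ∘ σ = y then s.character σ else 0

/-- The projected operator `A_± = Π_± A Π_±`. -/
noncomputable def compress (s : Statistics) {N d : ℕ} (A : ManyBody N d) : ManyBody N d :=
  symProj s N d * A * symProj s N d

/-- The exponential of `A_±` as an operator on the symmetric / antisymmetric subspace, extended
by zero on the orthogonal complement. (The exponential of `A_±` on the whole tensor product is
block diagonal, and it is the identity on the complement; the factor `Π_±` removes that block.)
In particular its trace is the trace over the subspace. -/
noncomputable def sectorExp (s : Statistics) {N d : ℕ} (A : ManyBody N d) : ManyBody N d :=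
  symProj s N d * NormedSpace.exp (compress s A)

/-- Bosonic / fermionic density matrices: the density matrices on the symmetric / antisymmetric
subspace, seen as density matrices on the tensor product that live on that subspace. -/
def IsSectorDensity (s : Statistics) {N d : ℕ} (Γ : ManyBody N d) : Prop :=
  IsDensity Γ ∧ compress s Γ = Γ

/-- The primal functional `Tr(H Γ) + ε Tr(Γ log Γ)`, where `0 log 0 = 0`. -/
noncomputable def primalEnergy {N d : ℕ} (ε : ℝ) (H Γ : ManyBody N d) : ℝ :=
  (H * Γ).trace.re + ε * (Γ * cfc Real.log Γ).trace.re

/-- Competitors of the primal problem with marginal `γ`. -/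
def IsAdmissible (s : Statistics) {N d : ℕ} (γ : OneBody d) (Γ : ManyBody N d) : Prop :=
  IsSectorDensity s Γ ∧ HasMarginals Γ γ

/-- The value of the primal problem (`+∞` if there is no competitor). -/
noncomputable def primalValue (s : Statistics) {N d : ℕ} (ε : ℝ) (H : ManyBody N d)
    (γ : OneBody d) : EReal :=
  ⨅ (Γ : ManyBody N d) (_ : IsAdmissible s γ Γ), (primalEnergy ε H Γ : EReal)

/-- `Γ` solves the primal problem. -/
def IsPrimalMinimiser (s : Statistics) {N d : ℕ} (ε : ℝ) (H : ManyBody N d) (γ : OneBody d)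
    (Γ : ManyBody N d) : Prop :=
  IsAdmissible s γ Γ ∧
    ∀ Γ' : ManyBody N d, IsAdmissible s γ Γ' → primalEnergy ε H Γ ≤ primalEnergy ε H Γ'

/-- `exp (ε⁻¹ [N⁻¹ (U ⊕ ⋯ ⊕ U) - H]_±)` on the symmetric / antisymmetric subspace. -/
noncomputable def gibbs (s : Statistics) {N d : ℕ} (ε : ℝ) (H : ManyBody N d)
    (U : OneBody d) : ManyBody N d :=
  sectorExp s ((ε : ℂ)⁻¹ • ((N : ℂ)⁻¹ • kroneckerSum N U - H))

/-- The dual functional `Tr(U γ) - ε Tr(exp (ε⁻¹ [N⁻¹ (U ⊕ ⋯ ⊕ U) - H]_±)) + ε`. -/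
noncomputable def dualFunctional (s : Statistics) {N d : ℕ} (ε : ℝ) (H : ManyBody N d)
    (γ U : OneBody d) : ℝ :=
  (U * γ).trace.re - ε * (gibbs s ε H U).trace.re + ε

/-- The value of the dual problem: the supremum over Hermitian `U`. -/
noncomputable def dualValue (s : Statistics) {N d : ℕ} (ε : ℝ) (H : ManyBody N d)
    (γ : OneBody d) : EReal :=
  ⨆ (U : OneBody d) (_ : U.IsHermitian), (dualFunctional s ε H γ U : EReal)

/-- `U` maximises the dual functional over the Hermitian matrices. -/
def IsDualMaximiser (s : Statistics) {N d : ℕ} (ε : ℝ) (H : ManyBody N d) (γ U : OneBody d) :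
    Prop :=
  U.IsHermitian ∧
    ∀ V : OneBody d, V.IsHermitian → dualFunctional s ε H γ V ≤ dualFunctional s ε H γ U

/-- The primal and dual problems have the same, finite value. -/
def DualityHolds (s : Statistics) {N d : ℕ} (ε : ℝ) (H : ManyBody N d) (γ : OneBody d) : Prop :=
  primalValue s ε H γ = dualValue s ε H γ ∧ ∃ v : ℝ, primalValue s ε H γ = (v : EReal)

/-- There is exactly one dual maximiser `U`, and the associated exponential is the one and only
primal minimiser. -/
def UniqueOptimisers (s : Statistics) {N d : ℕ} (ε : ℝ) (H : ManyBody N d) (γ : OneBody d) :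
    Prop :=
  ∃ U : OneBody d,
    IsDualMaximiser s ε H γ U ∧
    (∀ V : OneBody d, IsDualMaximiser s ε H γ V → V = U) ∧
    IsPrimalMinimiser s ε H γ (gibbs s ε H U) ∧
    ∀ Γ : ManyBody N d, IsPrimalMinimiser s ε H γ Γ → Γ = gibbs s ε H U

end QuantumOT

open QuantumOT

/-!
By Klein's inequality, a positive semidefinite `Γ` in the symmetry sector and a Hermitian source `B`
satisfy `Tr(B Γ) - ε Tr exp(ε⁻¹ [B - H]) ≤ Tr(H Γ) + ε Tr(Γ log Γ) - ε Tr Γ`, with equality only if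
`Γ = exp(ε⁻¹ [B - H])`. For `B = N⁻¹ (U ⊕ ⋯ ⊕ U)` and a competitor `Γ` this is weak duality, and the
Euler–Lagrange equation of a dual maximiser `U` says that its Gibbs state is a competitor, hence the
unique minimiser.

If some competitor dominates a positive multiple of the projection, then it can be perturbed in the
direction of any source, which makes the dual functional coercive, so that a maximiser exists. Any
other problem is mixed with the maximally mixed state; as the weight of the mixture tends to zero,
compactness gives a competitor whose energy is at most the dual supremum.

Diagonalising `γ` reduces the existence of competitors to vectors of occupation numbers. For bosons
these are convex combinations of the vertices of the simplex; for fermions they are, by Birkhoff's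
theorem, convex combinations of the occupation numbers of Slater determinants. If `γ > 0` (and
`γ < 1/N` for fermions), all small trace-free perturbations of `γ` have competitors too. Hence `γ`
itself has a competitor dominating a positive multiple of the projection, and `[U ⊕ ⋯ ⊕ U]`
determines `U`, which makes the maximiser unique.
-/

namespace QuantumOT

open Matrix Filter Topology

section Klein

variable {ι κ : Type*} [Fintype ι] [DecidableEq ι] [Fintype κ] [DecidableEq κ]
  {A : Matrix ι ι ℂ} {B : Matrix κ κ ℂ}

/-- The matrix of `Q` with respect to orthonormal eigenbases of the Hermitian matrices `A`
and `B`, in which `f(A) Q` and `Q f(B)` are computed entrywise. -/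
noncomputable def inEigenbases (hA : A.IsHermitian) (hB : B.IsHermitian) (Q : Matrix ι κ ℂ) :
    Matrix ι κ ℂ :=
  (hA.eigenvectorUnitary : Matrix ι ι ℂ)ᴴ * Q * (hB.eigenvectorUnitary : Matrix κ κ ℂ)

lemma cfc_eq_eigenvectorUnitary_conj (hA : A.IsHermitian) (f : ℝ → ℝ) :
    cfc f A = (hA.eigenvectorUnitary : Matrix ι ι ℂ) *
      diagonal (fun i => (f (hA.eigenvalues i) : ℂ)) *
        (hA.eigenvectorUnitary : Matrix ι ι ℂ)ᴴ := by
  rw [hA.cfc_eq]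
  rfl

lemma inEigenbases_cfc_mul (hA : A.IsHermitian) (hB : B.IsHermitian) (f : ℝ → ℝ)
    (Q : Matrix ι κ ℂ) :
    inEigenbases hA hB (cfc f A * Q) =
      diagonal (fun i => (f (hA.eigenvalues i) : ℂ)) * inEigenbases hA hB Q := by
  have hV : (hA.eigenvectorUnitary : Matrix ι ι ℂ)ᴴ * hA.eigenvectorUnitary = 1 :=
    Unitary.coe_star_mul_self _
  simp only [inEigenbases, cfc_eq_eigenvectorUnitary_conj hA, ← Matrix.mul_assoc, hV,
    Matrix.one_mul]

lemma inEigenbases_mul_cfc (hA : A.IsHermitian) (hB : B.IsHermitian) (f : ℝ → ℝ)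
    (Q : Matrix ι κ ℂ) :
    inEigenbases hA hB (Q * cfc f B) =
      inEigenbases hA hB Q * diagonal (fun j => (f (hB.eigenvalues j) : ℂ)) := by
  have hW : (hB.eigenvectorUnitary : Matrix κ κ ℂ)ᴴ * hB.eigenvectorUnitary = 1 :=
    Unitary.coe_star_mul_self _
  simp only [inEigenbases, cfc_eq_eigenvectorUnitary_conj hB, Matrix.mul_assoc, hW,
    Matrix.mul_one]

lemma trace_inEigenbases_mul_conjTranspose (hA : A.IsHermitian) (hB : B.IsHermitian)
    (Q R : Matrix ι κ ℂ) :
    (inEigenbases hA hB Q * (inEigenbases hA hB R)ᴴ).trace = (Q * Rᴴ).trace := by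
  have hV : (hA.eigenvectorUnitary : Matrix ι ι ℂ) *
      (hA.eigenvectorUnitary : Matrix ι ι ℂ)ᴴ = 1 := Unitary.coe_mul_star_self _
  have hW : (hB.eigenvectorUnitary : Matrix κ κ ℂ) *
      (hB.eigenvectorUnitary : Matrix κ κ ℂ)ᴴ = 1 := Unitary.coe_mul_star_self _
  simp only [inEigenbases, conjTranspose_mul, conjTranspose_conjTranspose, Matrix.mul_assoc]
  rw [← Matrix.mul_assoc _ (hB.eigenvectorUnitary : Matrix κ κ ℂ)ᴴ, hW, Matrix.one_mul,
    Matrix.trace_mul_comm]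
  simp only [Matrix.mul_assoc, hV, Matrix.mul_one]

lemma inEigenbases_injective (hA : A.IsHermitian) (hB : B.IsHermitian) :
    Function.Injective (inEigenbases hA hB) := by
  intro Q R h
  have hsub : inEigenbases hA hB (Q - R) = 0 := by
    simpa only [inEigenbases, Matrix.mul_sub, Matrix.sub_mul, sub_eq_zero] using h
  have htrace := trace_inEigenbases_mul_conjTranspose hA hB (Q - R) (Q - R)
  rw [hsub, Matrix.zero_mul, Matrix.trace_zero, eq_comm,
    Matrix.trace_mul_conjTranspose_self_eq_zero_iff] at htrace
  exact sub_eq_zero.1 htrace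

lemma re_trace_cfc_mul_mul_cfc_mul_conjTranspose (hA : A.IsHermitian) (hB : B.IsHermitian)
    (f h : ℝ → ℝ) (Q : Matrix ι κ ℂ) :
    (cfc f A * Q * cfc h B * Qᴴ).trace.re =
      ∑ i, ∑ j, f (hA.eigenvalues i) * h (hB.eigenvalues j) *
        Complex.normSq (inEigenbases hA hB Q i j) := by
  rw [Matrix.mul_assoc (cfc f A), ← trace_inEigenbases_mul_conjTranspose hA hB,
    inEigenbases_cfc_mul, inEigenbases_mul_cfc, Matrix.trace, Complex.re_sum]
  refine Finset.sum_congr rfl fun i _ => ?_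
  rw [diag_apply, Matrix.mul_apply, Complex.re_sum]
  refine Finset.sum_congr rfl fun j _ => ?_
  rw [diagonal_mul, mul_diagonal, conjTranspose_apply, Complex.star_def,
    show ∀ w x y z : ℂ, w * (x * y) * z = w * y * (x * z) by intros; ring, Complex.mul_conj]
  norm_cast

lemma mul_log_sub_add_exp_nonneg {x : ℝ} (hx : 0 ≤ x) (a : ℝ) :
    0 ≤ x * Real.log x - x * a + Real.exp a - x := by
  rcases hx.eq_or_lt with rfl | hx
  · simpa using (Real.exp_pos a).le
  · have h := Real.add_one_le_exp (a - Real.log x)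
    rw [Real.exp_sub, Real.exp_log hx, le_div_iff₀ hx] at h
    linarith

lemma mul_log_sub_add_exp_eq_zero_iff {x : ℝ} (hx : 0 ≤ x) {a : ℝ} :
    x * Real.log x - x * a + Real.exp a - x = 0 ↔ x = Real.exp a := by
  refine ⟨fun h => ?_, fun h => by rw [h, Real.log_exp]; ring⟩
  rcases hx.eq_or_lt with rfl | hx
  · simp at h
  · by_contra hne
    have h1 := Real.add_one_lt_exp (sub_ne_zero.2 fun h0 => hne (by rw [h0, Real.exp_log hx]) :
      a - Real.log x ≠ 0)
    rw [Real.exp_sub, Real.exp_log hx, lt_div_iff₀ hx] at h1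
    linarith

open scoped Matrix.Norms.L2Operator in
lemma exp_eq_cfc (hA : A.IsHermitian) : NormedSpace.exp A = cfc Real.exp A :=
  (CFC.real_exp_eq_normedSpace_exp hA.isSelfAdjoint).symm

lemma mul_cfc_log_eq_cfc (hB : B.IsHermitian) :
    B * cfc Real.log B = cfc (fun x => x * Real.log x) B := by
  have hspec : (spectrum ℝ B).Finite := Matrix.finite_real_spectrum
  rw [cfc_mul (fun x => x) Real.log B continuousOn_id (hspec.continuousOn _),
    cfc_id' ℝ B hB.isSelfAdjoint]

/-- The gap in Klein's inequality, for an intertwiner `Q` between the spaces on which `A` and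
`B` act. -/
noncomputable def kleinGap (A : Matrix ι ι ℂ) (B : Matrix κ κ ℂ) (Q : Matrix ι κ ℂ) : ℝ :=
  (Q * (B * cfc Real.log B) * Qᴴ).trace.re - (A * Q * B * Qᴴ).trace.re +
    (NormedSpace.exp A * Q * Qᴴ).trace.re - (Q * B * Qᴴ).trace.re

lemma kleinGap_eq_sum (hA : A.IsHermitian) (hB : B.IsHermitian) (Q : Matrix ι κ ℂ) :
    kleinGap A B Q = ∑ i, ∑ j,
      (hB.eigenvalues j * Real.log (hB.eigenvalues j) - hB.eigenvalues j * hA.eigenvalues i +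
        Real.exp (hA.eigenvalues i) - hB.eigenvalues j) *
          Complex.normSq (inEigenbases hA hB Q i j) := by
  have key := fun f h => re_trace_cfc_mul_mul_cfc_mul_conjTranspose hA hB f h Q
  have hentropy := key (fun _ => 1) (fun x => x * Real.log x)
  have henergy := key id id
  have hexp := key Real.exp (fun _ => 1)
  have hmass := key (fun _ => 1) id
  rw [cfc_const_one ℝ A hA.isSelfAdjoint, ← mul_cfc_log_eq_cfc hB, Matrix.one_mul] at hentropy
  rw [cfc_id ℝ A hA.isSelfAdjoint, cfc_id ℝ B hB.isSelfAdjoint] at henergy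
  rw [cfc_const_one ℝ B hB.isSelfAdjoint, ← exp_eq_cfc hA, Matrix.mul_one] at hexp
  rw [cfc_const_one ℝ A hA.isSelfAdjoint, cfc_id ℝ B hB.isSelfAdjoint, Matrix.one_mul] at hmass
  rw [kleinGap, hentropy, henergy, hexp, hmass]
  simp only [← Finset.sum_sub_distrib, ← Finset.sum_add_distrib, id]
  refine Finset.sum_congr rfl fun i _ => Finset.sum_congr rfl fun j _ => ?_
  ring

lemma kleinGap_nonneg (hA : A.IsHermitian) (hB : B.PosSemidef) (Q : Matrix ι κ ℂ) :
    0 ≤ kleinGap A B Q := by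
  rw [kleinGap_eq_sum hA hB.1]
  exact Finset.sum_nonneg fun i _ => Finset.sum_nonneg fun j _ =>
    mul_nonneg (mul_log_sub_add_exp_nonneg (hB.eigenvalues_nonneg j) _) (Complex.normSq_nonneg _)

lemma kleinGap_eq_zero_iff (hA : A.IsHermitian) (hB : B.PosSemidef) (Q : Matrix ι κ ℂ) :
    kleinGap A B Q = 0 ↔ Q * B = NormedSpace.exp A * Q := by
  have hterm : ∀ i j, 0 ≤ (hB.1.eigenvalues j * Real.log (hB.1.eigenvalues j) -
      hB.1.eigenvalues j * hA.eigenvalues i + Real.exp (hA.eigenvalues i) -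
        hB.1.eigenvalues j) * Complex.normSq (inEigenbases hA hB.1 Q i j) := fun i j =>
    mul_nonneg (mul_log_sub_add_exp_nonneg (hB.eigenvalues_nonneg j) _) (Complex.normSq_nonneg _)
  have hQB := inEigenbases_mul_cfc hA hB.1 id Q
  rw [cfc_id ℝ B hB.1.isSelfAdjoint] at hQB
  rw [kleinGap_eq_sum hA hB.1, exp_eq_cfc hA, ← (inEigenbases_injective hA hB.1).eq_iff, hQB,
    inEigenbases_cfc_mul, Finset.sum_eq_zero_iff_of_nonneg
      fun i _ => Finset.sum_nonneg fun j _ => hterm i j, ← Matrix.ext_iff]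
  simp only [Finset.sum_eq_zero_iff_of_nonneg fun j _ => hterm _ j, Finset.mem_univ,
    true_implies, mul_eq_zero, mul_log_sub_add_exp_eq_zero_iff (hB.eigenvalues_nonneg _),
    Complex.normSq_eq_zero, mul_diagonal, diagonal_mul, id]
  refine forall₂_congr fun i j => ?_
  rw [mul_comm (inEigenbases hA hB.1 Q i j), mul_eq_mul_right_iff, Complex.ofReal_inj]

end Klein

section Compression

lemma isHermitian_smul_sub {ι : Type*} {H B : Matrix ι ι ℂ} (ε : ℝ) (hH : H.IsHermitian)
    (hB : B.IsHermitian) : ((ε : ℂ)⁻¹ • (B - H)).IsHermitian := by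
  rw [← Complex.ofReal_inv]
  exact (hB.sub hH).smul (Complex.conj_ofReal _)

variable {ι : Type*} [Fintype ι] {P A Γ : Matrix ι ι ℂ}

lemma proj_mul_of_compress_eq (hP : IsStarProjection P) (hΓ : P * Γ * P = Γ) : P * Γ = Γ := by
  rw [← hΓ, ← Matrix.mul_assoc, ← Matrix.mul_assoc, hP.isIdempotentElem.eq]

lemma mul_proj_of_compress_eq (hP : IsStarProjection P) (hΓ : P * Γ * P = Γ) : Γ * P = Γ := by
  rw [← hΓ, Matrix.mul_assoc, hP.isIdempotentElem.eq]

lemma compress_compress (hP : IsStarProjection P) (A : Matrix ι ι ℂ) :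
    P * (P * A * P) * P = P * A * P := by
  simp only [← Matrix.mul_assoc, hP.isIdempotentElem.eq]
  rw [Matrix.mul_assoc, hP.isIdempotentElem.eq]

lemma isHermitian_compress (hP : IsStarProjection P) (hA : A.IsHermitian) :
    (P * A * P).IsHermitian := by
  simpa only [hP.isSelfAdjoint.isHermitian.eq] using isHermitian_mul_mul_conjTranspose P hA

lemma posSemidef_of_isStarProjection (hP : IsStarProjection P) : P.PosSemidef := by
  simpa only [hP.isSelfAdjoint.isHermitian.eq, hP.isIdempotentElem.eq] using
    posSemidef_self_mul_conjTranspose P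

lemma trace_compress_mul (hP : IsStarProjection P) (hΓ : P * Γ * P = Γ) (A : Matrix ι ι ℂ) :
    (P * A * P * Γ).trace = (A * Γ).trace := by
  rw [Matrix.mul_assoc, proj_mul_of_compress_eq hP hΓ, Matrix.mul_assoc, Matrix.trace_mul_comm,
    Matrix.mul_assoc, mul_proj_of_compress_eq hP hΓ]

end Compression

section Block

variable {ι : Type*} [Fintype ι] [DecidableEq ι] {P A B H Γ : Matrix ι ι ℂ} {ε : ℝ}

/-- The exponential of the compression of `A` to the range of the projection `P`, computed on
that range and extended by zero. -/
noncomputable def blockExp (P A : Matrix ι ι ℂ) : Matrix ι ι ℂ :=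
  P * NormedSpace.exp (P * A * P)

open scoped Matrix.Norms.L2Operator in
lemma commute_proj_exp_compress (hP : IsStarProjection P) (A : Matrix ι ι ℂ) :
    P * NormedSpace.exp (P * A * P) = NormedSpace.exp (P * A * P) * P := by
  have hPA := compress_compress hP A
  have hcomm : Commute P (P * A * P) :=
    (proj_mul_of_compress_eq hP hPA).trans (mul_proj_of_compress_eq hP hPA).symm
  exact hcomm.exp_right.eq

open scoped MatrixOrder in
lemma posSemidef_exp (hA : A.IsHermitian) : (NormedSpace.exp A).PosSemidef := by
  rw [exp_eq_cfc hA, ← Matrix.nonneg_iff_posSemidef]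
  exact cfc_nonneg fun x _ => (Real.exp_pos x).le

lemma posSemidef_blockExp (hP : IsStarProjection P) (hA : A.IsHermitian) :
    (blockExp P A).PosSemidef := by
  have h := (posSemidef_exp (isHermitian_compress hP hA)).mul_mul_conjTranspose_same P
  rwa [hP.isSelfAdjoint.isHermitian.eq, commute_proj_exp_compress hP, Matrix.mul_assoc,
    hP.isIdempotentElem.eq, ← commute_proj_exp_compress hP] at h

lemma compress_blockExp (hP : IsStarProjection P) (A : Matrix ι ι ℂ) :
    P * blockExp P A * P = blockExp P A := by
  rw [blockExp, ← Matrix.mul_assoc, hP.isIdempotentElem.eq, commute_proj_exp_compress hP,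
    Matrix.mul_assoc, hP.isIdempotentElem.eq]

open scoped Matrix.Norms.L2Operator in
lemma exp_compress_eq_blockExp_add (hP : IsStarProjection P) (A : Matrix ι ι ℂ) :
    NormedSpace.exp (P * A * P) = blockExp P A + (1 - P) := by
  let +nondep : NormedAlgebra ℚ (Matrix ι ι ℂ) := .restrictScalars ℚ ℂ _
  have hzero : (1 - P) * (P * A * P) = 0 := by
    rw [Matrix.sub_mul, Matrix.one_mul, proj_mul_of_compress_eq hP (compress_compress hP A),
      sub_self]
  have hsemi : SemiconjBy (1 - P) (P * A * P) 0 := hzero.trans (Matrix.zero_mul _).symm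
  have hexp := hsemi.exp_right.eq
  rw [NormedSpace.exp_zero, Matrix.one_mul, Matrix.sub_mul, Matrix.one_mul,
    sub_eq_iff_eq_add] at hexp
  rw [hexp, blockExp, add_comm]

open scoped Matrix.Norms.L2Operator in
lemma compress_eq_of_blockExp_eq (hP : IsStarProjection P) (hA : A.IsHermitian)
    (hB : B.IsHermitian) (h : blockExp P A = blockExp P B) : P * A * P = P * B * P := by
  have hexp : NormedSpace.exp (P * A * P) = NormedSpace.exp (P * B * P) := by
    rw [exp_compress_eq_blockExp_add hP, h, ← exp_compress_eq_blockExp_add hP]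
  rw [← CFC.log_exp (P * A * P) (isHermitian_compress hP hA).isSelfAdjoint, hexp,
    CFC.log_exp _ (isHermitian_compress hP hB).isSelfAdjoint]

/-- The free energy at temperature `ε` of a matrix that need not have trace one; the term
`- ε Tr Γ` makes the Gibbs state with source `B` optimal without normalisation. -/
noncomputable def freeEnergy (ε : ℝ) (H Γ : Matrix ι ι ℂ) : ℝ :=
  (H * Γ).trace.re + ε * ((Γ * cfc Real.log Γ).trace.re - Γ.trace.re)

/-- The Gibbs state of the Hamiltonian `H` with source `B` on the range of `P`. -/
noncomputable def gibbsState (P : Matrix ι ι ℂ) (ε : ℝ) (H B : Matrix ι ι ℂ) : Matrix ι ι ℂ :=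
  blockExp P ((ε : ℂ)⁻¹ • (B - H))

lemma freeEnergy_eq_add_kleinGap (hP : IsStarProjection P) (hε : ε ≠ 0)
    (hΓ : P * Γ * P = Γ) :
    freeEnergy ε H Γ = (B * Γ).trace.re - ε * (gibbsState P ε H B).trace.re +
      ε * kleinGap (P * ((ε : ℂ)⁻¹ • (B - H)) * P) Γ P := by
  have hPΓ := proj_mul_of_compress_eq hP hΓ
  have hΓP := mul_proj_of_compress_eq hP hΓ
  have hPP := hP.isIdempotentElem.eq
  have hentropy : (P * (Γ * cfc Real.log Γ) * P).trace = (Γ * cfc Real.log Γ).trace := by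
    rw [Matrix.trace_mul_comm, ← Matrix.mul_assoc, hPP, ← Matrix.mul_assoc, hPΓ]
  have henergy : (P * ((ε : ℂ)⁻¹ • (B - H)) * P * P * Γ * P).trace.re =
      ε⁻¹ * ((B * Γ).trace.re - (H * Γ).trace.re) := by
    rw [Matrix.mul_assoc _ Γ, hΓP, Matrix.mul_assoc _ P P, hPP, trace_compress_mul hP hΓ,
      Matrix.smul_mul, Matrix.trace_smul, Matrix.sub_mul, Matrix.trace_sub, smul_eq_mul,
      ← Complex.ofReal_inv, Complex.re_ofReal_mul, Complex.sub_re]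
  have hmass : NormedSpace.exp (P * ((ε : ℂ)⁻¹ • (B - H)) * P) * P * P =
      gibbsState P ε H B := by
    rw [Matrix.mul_assoc, hPP, ← commute_proj_exp_compress hP, gibbsState, blockExp]
  rw [kleinGap, hP.isSelfAdjoint.isHermitian.eq, hentropy, henergy, hmass, hΓ, freeEnergy]
  field_simp
  ring

theorem le_freeEnergy (hP : IsStarProjection P) (hε : 0 < ε) (hH : H.IsHermitian)
    (hB : B.IsHermitian) (hΓ : Γ.PosSemidef) (hPΓ : P * Γ * P = Γ) :
    (B * Γ).trace.re - ε * (gibbsState P ε H B).trace.re ≤ freeEnergy ε H Γ := by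
  rw [freeEnergy_eq_add_kleinGap (B := B) hP hε.ne' hPΓ]
  exact le_add_of_nonneg_right (mul_nonneg hε.le (kleinGap_nonneg
    (isHermitian_compress hP (isHermitian_smul_sub ε hH hB)) hΓ P))

theorem freeEnergy_eq_iff_eq_gibbsState (hP : IsStarProjection P) (hε : ε ≠ 0)
    (hH : H.IsHermitian) (hB : B.IsHermitian) (hΓ : Γ.PosSemidef) (hPΓ : P * Γ * P = Γ) :
    freeEnergy ε H Γ = (B * Γ).trace.re - ε * (gibbsState P ε H B).trace.re ↔
      Γ = gibbsState P ε H B := by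
  rw [freeEnergy_eq_add_kleinGap (B := B) hP hε hPΓ, add_eq_left, mul_eq_zero_iff_left hε,
    kleinGap_eq_zero_iff (isHermitian_compress hP (isHermitian_smul_sub ε hH hB)) hΓ,
    proj_mul_of_compress_eq hP hPΓ, ← commute_proj_exp_compress hP, gibbsState, blockExp]

lemma posSemidef_gibbsState (hP : IsStarProjection P) (ε : ℝ) (hH : H.IsHermitian)
    (hB : B.IsHermitian) : (gibbsState P ε H B).PosSemidef :=
  posSemidef_blockExp hP (isHermitian_smul_sub ε hH hB)

lemma compress_gibbsState (hP : IsStarProjection P) (ε : ℝ) (H B : Matrix ι ι ℂ) :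
    P * gibbsState P ε H B * P = gibbsState P ε H B :=
  compress_blockExp hP _

end Block

section Topology

lemma isClosed_setOf_posSemidef {ι : Type*} [Finite ι] :
    IsClosed {M : Matrix ι ι ℂ | M.PosSemidef} := by
  have := Fintype.ofFinite ι
  simp only [Matrix.posSemidef_iff_dotProduct_mulVec, Set.ofPred_and, Set.ofPred_forall]
  refine IsClosed.inter (isClosed_eq (by fun_prop) (by fun_prop)) (isClosed_iInter fun x => ?_)
  exact isClosed_le continuous_const (by fun_prop)

variable {ι : Type*} [Fintype ι] [DecidableEq ι] {A P Γ : Matrix ι ι ℂ}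

open scoped Matrix.Norms.L2Operator in
lemma continuous_matrix_exp : Continuous fun M : Matrix ι ι ℂ => NormedSpace.exp M :=
  let +nondep : NormedAlgebra ℚ (Matrix ι ι ℂ) := .restrictScalars ℚ ℂ _
  NormedSpace.exp_continuous

lemma continuous_gibbsState (P : Matrix ι ι ℂ) (ε : ℝ) (H : Matrix ι ι ℂ) :
    Continuous (gibbsState P ε H) := by
  have hsource : Continuous fun B : Matrix ι ι ℂ => (ε : ℂ)⁻¹ • (B - H) := by fun_prop
  exact continuous_const.matrix_mul (continuous_matrix_exp.comp
    ((continuous_const.matrix_mul hsource).matrix_mul continuous_const))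

open scoped Matrix.Norms.L2Operator

lemma continuousOn_freeEnergy (ε : ℝ) (H : Matrix ι ι ℂ) :
    ContinuousOn (freeEnergy ε H) {Γ | Γ.IsHermitian} := by
  have hentropy : ContinuousOn (fun Γ : Matrix ι ι ℂ => Γ * cfc Real.log Γ)
      {Γ | Γ.IsHermitian} :=
    (continuousOn_id.cfc_of_mem_nhdsSet (s := Set.univ) (fun x : ℝ => x * Real.log x) univ_mem
      (fun _ h => h) Real.continuous_mul_log.continuousOn).congr fun _ h => mul_cfc_log_eq_cfc h
  have hre {f : Matrix ι ι ℂ → Matrix ι ι ℂ} {s : Set (Matrix ι ι ℂ)} (hf : ContinuousOn f s) :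
      ContinuousOn (fun Γ => (f Γ).trace.re) s :=
    (Complex.continuous_re.comp continuous_id.matrix_trace).comp_continuousOn hf
  exact (hre (by fun_prop)).add (continuousOn_const.mul ((hre hentropy).sub (hre continuousOn_id)))

lemma norm_le_re_trace (hA : A.PosSemidef) : ‖A‖ ≤ A.trace.re := by
  have htrace : A.trace.re = ∑ i, hA.1.eigenvalues i := by
    rw [hA.1.trace_eq_sum_eigenvalues, Complex.re_sum]
    rfl
  rw [htrace]
  conv_lhs => rw [← cfc_id ℝ A hA.1.isSelfAdjoint]
  refine norm_cfc_le (Finset.sum_nonneg fun i _ => hA.eigenvalues_nonneg i) fun x hx => ?_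
  rw [hA.1.spectrum_real_eq_range_eigenvalues] at hx
  obtain ⟨i, rfl⟩ := hx
  rw [id, Real.norm_of_nonneg (hA.eigenvalues_nonneg i)]
  exact Finset.single_le_sum (fun i _ => hA.eigenvalues_nonneg i) (Finset.mem_univ i)

lemma norm_sq_le_re_trace_mul_self (hA : A.IsHermitian) : ‖A‖ ^ 2 ≤ (A * A).trace.re := by
  have h := norm_le_re_trace (posSemidef_conjTranspose_mul_self A)
  rwa [hA.eq, hA.isSelfAdjoint.norm_mul_self] at h

lemma isCompact_setOf_posSemidef_trace_le {ι : Type*} [Fintype ι] (K : ℝ) :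
    IsCompact {Γ : Matrix ι ι ℂ | Γ.PosSemidef ∧ Γ.trace.re ≤ K} := by
  classical
  have : ProperSpace (Matrix ι ι ℂ) := FiniteDimensional.proper ℂ _
  refine (isCompact_closedBall 0 K).of_isClosed_subset ?_ fun Γ hΓ =>
    mem_closedBall_zero_iff.2 ((norm_le_re_trace hΓ.1).trans hΓ.2)
  exact isClosed_setOf_posSemidef.inter (isClosed_le
    (Complex.continuous_re.comp continuous_id.matrix_trace) continuous_const)

open scoped MatrixOrder in
lemma posSemidef_norm_smul_one_add (hA : A.IsHermitian) :
    (‖A‖ • (1 : Matrix ι ι ℂ) + A).PosSemidef := by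
  have h := hA.isSelfAdjoint.neg_algebraMap_norm_le_self
  rwa [Algebra.algebraMap_eq_smul_one, neg_le_iff_add_nonneg', Matrix.nonneg_iff_posSemidef] at h

lemma posSemidef_add_smul_of_compress_eq (hP : IsStarProjection P) (hA : A.IsHermitian)
    (hPA : P * A * P = A) {c : ℝ} (hc : 0 ≤ c) (hΓ : (Γ - c • P).PosSemidef) :
    (Γ + (c / ‖A‖) • A).PosSemidef := by
  rcases eq_or_ne A 0 with rfl | hA0
  · simpa using hΓ.add ((posSemidef_of_isStarProjection hP).smul hc)
  · have h := ((posSemidef_norm_smul_one_add hA).mul_mul_conjTranspose_same P).smul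
      (div_nonneg hc (norm_nonneg A))
    rw [hP.isSelfAdjoint.isHermitian.eq, Matrix.mul_add, Matrix.add_mul, hPA, Matrix.mul_smul,
      Matrix.mul_one, Matrix.smul_mul, hP.isIdempotentElem.eq, smul_add, smul_smul,
      div_mul_cancel₀ _ (norm_ne_zero_iff.2 hA0)] at h
    simpa only [sub_add_add_cancel, ← add_assoc, sub_add_cancel] using hΓ.add h

end Topology

/-- Minimisation of a free energy over positive semidefinite matrices supported in the range of
the projection `P`, with prescribed expectations of the Hermitian observables `K u`, whose labels
`u` form the real vector space `E` of Lagrange multipliers. -/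
structure EntropicProblem (ι E : Type*) [Fintype ι] [AddCommGroup E] [Module ℝ E] where
  ε : ℝ
  ε_pos : 0 < ε
  H : Matrix ι ι ℂ
  isHermitian_H : H.IsHermitian
  P : Matrix ι ι ℂ
  isStarProjection_P : IsStarProjection P
  K : E →ₗ[ℝ] Matrix ι ι ℂ
  isHermitian_K : ∀ u, (K u).IsHermitian

namespace EntropicProblem

variable {ι E : Type*} [Fintype ι] [DecidableEq ι] [AddCommGroup E] [Module ℝ E]
  (p : EntropicProblem ι E) {g : Module.Dual ℝ E} {Γ : Matrix ι ι ℂ} {u v : E}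

/-- The expectations of the observables in the state `Γ`. -/
noncomputable def expectation : Matrix ι ι ℂ →ₗ[ℝ] Module.Dual ℝ E :=
  LinearMap.mk₂ ℝ (fun Γ u => (p.K u * Γ).trace.re)
    (by simp [Matrix.mul_add]) (by simp) (by simp [Matrix.add_mul]) (by simp)

lemma expectation_apply (Γ : Matrix ι ι ℂ) (u : E) :
    p.expectation Γ u = (p.K u * Γ).trace.re :=
  rfl

/-- The constraints of the primal problem, `g` being the prescribed expectations. -/
structure IsFeasible (g : Module.Dual ℝ E) (Γ : Matrix ι ι ℂ) : Prop where
  posSemidef : Γ.PosSemidef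
  compress_eq : p.P * Γ * p.P = Γ
  expectation_eq : p.expectation Γ = g

/-- The Gibbs state with Lagrange multiplier `u`. -/
noncomputable def gibbs (u : E) : Matrix ι ι ℂ :=
  gibbsState p.P p.ε p.H (p.K u)

/-- The dual functional, without normalisation of the trace. -/
noncomputable def dualObjective (g : Module.Dual ℝ E) (u : E) : ℝ :=
  g u - p.ε * (p.gibbs u).trace.re

/-- A feasible state is faithful if it dominates a positive multiple of `P`. -/
def IsFaithful (Γ : Matrix ι ι ℂ) : Prop :=
  ∃ c : ℝ, 0 < c ∧ (Γ - c • p.P).PosSemidef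

lemma posSemidef_gibbs (u : E) : (p.gibbs u).PosSemidef :=
  posSemidef_gibbsState p.isStarProjection_P p.ε p.isHermitian_H (p.isHermitian_K u)

lemma compress_gibbs (u : E) : p.P * p.gibbs u * p.P = p.gibbs u :=
  compress_gibbsState p.isStarProjection_P p.ε p.H (p.K u)

lemma continuous_gibbs_line (u w : E) : Continuous fun t : ℝ => p.gibbs (u + t • w) := by
  have hline : Continuous fun t : ℝ => p.K (u + t • w) := by
    simp only [map_add, map_smul]
    fun_prop
  exact (continuous_gibbsState p.P p.ε p.H).comp hline

lemma continuous_expectation (u : E) : Continuous fun Γ => p.expectation Γ u :=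
  Complex.continuous_re.comp (continuous_const.matrix_mul continuous_id).matrix_trace

variable {p}

lemma dualObjective_le_freeEnergy (hΓ : p.IsFeasible g Γ) (u : E) :
    p.dualObjective g u ≤ freeEnergy p.ε p.H Γ := by
  rw [dualObjective, ← hΓ.expectation_eq]
  exact le_freeEnergy p.isStarProjection_P p.ε_pos p.isHermitian_H (p.isHermitian_K u)
    hΓ.posSemidef hΓ.compress_eq

lemma freeEnergy_eq_dualObjective_iff (hΓ : p.IsFeasible g Γ) :
    freeEnergy p.ε p.H Γ = p.dualObjective g u ↔ Γ = p.gibbs u := by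
  rw [dualObjective, ← hΓ.expectation_eq]
  exact freeEnergy_eq_iff_eq_gibbsState p.isStarProjection_P p.ε_pos.ne' p.isHermitian_H
    (p.isHermitian_K u) hΓ.posSemidef hΓ.compress_eq

variable (p) in
lemma dualObjective_gibbs_expectation (u : E) :
    freeEnergy p.ε p.H (p.gibbs u) = p.dualObjective (p.expectation (p.gibbs u)) u :=
  (freeEnergy_eq_dualObjective_iff ⟨p.posSemidef_gibbs u, p.compress_gibbs u, rfl⟩).2 rfl

variable (p) in
/-- Convexity of the partition function, from the variational principle for the Gibbs state of
`u + w` and the source `u`. -/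
lemma trace_gibbs_add_sub_le (u w : E) :
    p.ε * ((p.gibbs (u + w)).trace.re - (p.gibbs u).trace.re) ≤
      p.expectation (p.gibbs (u + w)) w := by
  have h := dualObjective_le_freeEnergy
    ⟨p.posSemidef_gibbs (u + w), p.compress_gibbs (u + w), rfl⟩ u
  rw [dualObjective_gibbs_expectation, dualObjective, dualObjective, map_add] at h
  linarith

lemma isFeasible_gibbs_of_forall_le (hu : ∀ v, p.dualObjective g v ≤ p.dualObjective g u) :
    p.IsFeasible g (p.gibbs u) := by
  have hstep (w : E) {t : ℝ} (ht : 0 < t) : g w ≤ p.expectation (p.gibbs (u + t • w)) w := by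
    have hmax := hu (u + t • w)
    have hslope := p.trace_gibbs_add_sub_le u (t • w)
    rw [dualObjective, dualObjective, map_add, map_smul, smul_eq_mul] at hmax
    rw [map_smul, smul_eq_mul] at hslope
    exact le_of_mul_le_mul_left (by linarith) ht
  have hle (w : E) : g w ≤ p.expectation (p.gibbs u) w := by
    have hlim := (((p.continuous_expectation w).comp (p.continuous_gibbs_line u w)).tendsto
      (0 : ℝ)).mono_left (nhdsWithin_le_nhds (s := Set.Ioi 0))
    simp only [Function.comp_apply, zero_smul, add_zero] at hlim
    exact ge_of_tendsto hlim (eventually_mem_nhdsWithin.mono fun t ht => hstep w ht)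
  refine ⟨p.posSemidef_gibbs u, p.compress_gibbs u, LinearMap.ext fun w => le_antisymm ?_ (hle w)⟩
  simpa only [map_neg, neg_le_neg_iff] using hle (-w)

lemma freeEnergy_gibbs_of_forall_le (hu : ∀ v, p.dualObjective g v ≤ p.dualObjective g u) :
    freeEnergy p.ε p.H (p.gibbs u) = p.dualObjective g u :=
  (freeEnergy_eq_dualObjective_iff (isFeasible_gibbs_of_forall_le hu)).2 rfl

lemma eq_of_forall_dualObjective_le
    (hK : Function.Injective fun u => p.P * p.K u * p.P)
    (hu : ∀ w, p.dualObjective g w ≤ p.dualObjective g u)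
    (hv : ∀ w, p.dualObjective g w ≤ p.dualObjective g v) : u = v := by
  have hgibbs : p.gibbs u = p.gibbs v := by
    rw [← freeEnergy_eq_dualObjective_iff (isFeasible_gibbs_of_forall_le hu),
      freeEnergy_gibbs_of_forall_le hu]
    exact le_antisymm (hv u) (hu v)
  have hblock := compress_eq_of_blockExp_eq p.isStarProjection_P
    (isHermitian_smul_sub p.ε p.isHermitian_H (p.isHermitian_K u))
    (isHermitian_smul_sub p.ε p.isHermitian_H (p.isHermitian_K v)) hgibbs
  have hε : (p.ε : ℂ)⁻¹ ≠ 0 := inv_ne_zero (Complex.ofReal_ne_zero.2 p.ε_pos.ne')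
  simp only [Matrix.mul_smul, Matrix.smul_mul, Matrix.mul_sub, Matrix.sub_mul] at hblock
  exact hK (sub_left_injective (smul_right_injective _ hε hblock))

end EntropicProblem

namespace EntropicProblem

variable {ι E : Type*} [Fintype ι] [DecidableEq ι] [AddCommGroup E] [Module ℝ E]
  {p : EntropicProblem ι E} {g : Module.Dual ℝ E} {Γ : Matrix ι ι ℂ}

section Attainment

open scoped Matrix.Norms.L2Operator

variable (p) in
/-- The dual functional as a function of a source `A` on the range of `P`, the prescribed
expectations being those of `Γ`. -/
noncomputable def sourceObjective (Γ A : Matrix ι ι ℂ) : ℝ :=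
  (A * Γ).trace.re - p.ε * (gibbsState p.P p.ε p.H A).trace.re

lemma continuous_sourceObjective (Γ : Matrix ι ι ℂ) : Continuous (p.sourceObjective Γ) := by
  have henergy : Continuous fun A : Matrix ι ι ℂ => (A * Γ).trace.re :=
    Complex.continuous_re.comp (continuous_id.matrix_mul continuous_const).matrix_trace
  exact henergy.sub (continuous_const.mul (Complex.continuous_re.comp
    (continuous_gibbsState p.P p.ε p.H).matrix_trace))

lemma sourceObjective_compress (hΓ : p.P * Γ * p.P = Γ) (u : E) :
    p.sourceObjective Γ (p.P * p.K u * p.P) = p.dualObjective (p.expectation Γ) u := by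
  have hgibbs : gibbsState p.P p.ε p.H (p.P * p.K u * p.P) = p.gibbs u := by
    simp only [gibbs, gibbsState, blockExp, Matrix.mul_smul, Matrix.smul_mul, Matrix.mul_sub,
      Matrix.sub_mul, compress_compress p.isStarProjection_P]
  rw [sourceObjective, hgibbs, trace_compress_mul p.isStarProjection_P hΓ, dualObjective,
    expectation_apply]

/-- Testing the variational principle on `Γ + c A / ‖A‖`, which is still positive, gains the
coercive term `c ‖A‖`. -/
lemma exists_sourceObjective_le_sub_norm {c : ℝ} (hc : 0 < c)
    (hΓ : (Γ - c • p.P).PosSemidef) (hPΓ : p.P * Γ * p.P = Γ) :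
    ∃ M, ∀ A : Matrix ι ι ℂ, A.IsHermitian → p.P * A * p.P = A →
      p.sourceObjective Γ A ≤ M - c * ‖A‖ := by
  have hP := p.isStarProjection_P
  have : ProperSpace (Matrix ι ι ℂ) := FiniteDimensional.proper ℂ _
  obtain ⟨M, hM⟩ := ((isCompact_closedBall Γ c).inter_left isClosed_setOf_posSemidef).bddAbove_image
    ((continuousOn_freeEnergy p.ε p.H).mono fun X hX => hX.1.1)
  refine ⟨M, fun A hA hPA => ?_⟩
  set X := Γ + (c / ‖A‖) • A with hX
  have hXpos : X.PosSemidef := posSemidef_add_smul_of_compress_eq hP hA hPA hc.le hΓ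
  have hXball : X ∈ Metric.closedBall Γ c := by
    rw [mem_closedBall_iff_norm, hX, add_sub_cancel_left, norm_smul,
      Real.norm_of_nonneg (div_nonneg hc.le (norm_nonneg A)), div_mul_eq_mul_div, mul_div_assoc]
    exact mul_le_of_le_one_right hc.le (div_self_le_one _)
  have hPX : p.P * X * p.P = X := by
    rw [hX, Matrix.mul_add, Matrix.add_mul, hPΓ, Matrix.mul_smul, Matrix.smul_mul, hPA]
  have hgain : c * ‖A‖ ≤ c / ‖A‖ * (A * A).trace.re := by
    rcases eq_or_ne A 0 with rfl | hA0
    · simp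
    · rw [div_mul_eq_mul_div, le_div_iff₀ (norm_pos_iff.2 hA0), mul_assoc, ← sq]
      exact mul_le_mul_of_nonneg_left (norm_sq_le_re_trace_mul_self hA) hc.le
  have hvar := (le_freeEnergy hP p.ε_pos p.isHermitian_H hA hXpos hPX).trans
    (hM (Set.mem_image_of_mem _ ⟨hXpos, hXball⟩))
  rw [hX, Matrix.mul_add, Matrix.trace_add, Complex.add_re, Matrix.mul_smul, Matrix.trace_smul,
    Complex.smul_re, smul_eq_mul] at hvar
  rw [sourceObjective]
  linarith

lemma exists_forall_dualObjective_le (hΓ : p.IsFeasible g Γ) (hfaithful : p.IsFaithful Γ) :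
    ∃ u, ∀ v, p.dualObjective g v ≤ p.dualObjective g u := by
  obtain ⟨c, hc, hcΓ⟩ := hfaithful
  obtain ⟨M, hM⟩ := exists_sourceObjective_le_sub_norm hc hcΓ hΓ.compress_eq
  have : ProperSpace (Matrix ι ι ℂ) := FiniteDimensional.proper ℂ _
  let L : E →ₗ[ℝ] Matrix ι ι ℂ :=
    LinearMap.mulRight ℝ p.P ∘ₗ LinearMap.mulLeft ℝ p.P ∘ₗ p.K
  have hD (u : E) : p.dualObjective g u = p.sourceObjective Γ (L u) := by
    rw [← hΓ.expectation_eq]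
    exact (sourceObjective_compress hΓ.compress_eq u).symm
  have hcoercive : ∀ᶠ A in cocompact (Matrix ι ι ℂ) ⊓ 𝓟 (LinearMap.range L),
      p.sourceObjective Γ A ≤ p.sourceObjective Γ 0 := by
    rw [eventually_inf_principal]
    filter_upwards [(tendsto_norm_cocompact_atTop (E := Matrix ι ι ℂ)).eventually_ge_atTop
      ((M - p.sourceObjective Γ 0) / c)] with A hA
    rintro ⟨u, rfl⟩
    have hle := hM (L u) (isHermitian_compress p.isStarProjection_P (p.isHermitian_K u))
      (compress_compress p.isStarProjection_P (p.K u))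
    rw [div_le_iff₀' hc] at hA
    linarith
  obtain ⟨_, ⟨u, rfl⟩, hu⟩ := (continuous_sourceObjective Γ).continuousOn.exists_isMaxOn'
    (LinearMap.range L).closed_of_finiteDimensional (zero_mem _) hcoercive
  exact ⟨u, fun v => (hD v).trans_le ((hu ⟨v, rfl⟩).trans_eq (hD u).symm)⟩

end Attainment

section StrongDuality

/-- Mixing with `P` makes a feasible state faithful, so the perturbed problem is solvable. -/
lemma exists_freeEnergy_le_add (hΓ : p.IsFeasible g Γ) {b : ℝ}
    (hb : ∀ u, p.dualObjective g u ≤ b) {t : ℝ} (ht : t ∈ Set.Ioo (0 : ℝ) 1) :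
    ∃ G, p.IsFeasible ((1 - t) • g + t • p.expectation p.P) G ∧
      freeEnergy p.ε p.H G ≤ (1 - t) * b + t * freeEnergy p.ε p.H p.P := by
  have hP := p.isStarProjection_P
  have hPpos := posSemidef_of_isStarProjection hP
  have hPP : p.IsFeasible (p.expectation p.P) p.P :=
    ⟨hPpos, by rw [hP.isIdempotentElem.eq, hP.isIdempotentElem.eq], rfl⟩
  have hmix : p.IsFeasible ((1 - t) • g + t • p.expectation p.P) ((1 - t) • Γ + t • p.P) := by
    refine ⟨(hΓ.posSemidef.smul (sub_nonneg.2 ht.2.le)).add (hPpos.smul ht.1.le), ?_, ?_⟩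
    · rw [Matrix.mul_add, Matrix.add_mul, Matrix.mul_smul, Matrix.smul_mul, hΓ.compress_eq,
        Matrix.mul_smul, Matrix.smul_mul, hPP.compress_eq]
    · rw [map_add, map_smul, map_smul, hΓ.expectation_eq]
  have hfaithful : p.IsFaithful ((1 - t) • Γ + t • p.P) :=
    ⟨t, ht.1, by simpa using hΓ.posSemidef.smul (sub_nonneg.2 ht.2.le)⟩
  obtain ⟨u, hu⟩ := exists_forall_dualObjective_le hmix hfaithful
  refine ⟨p.gibbs u, isFeasible_gibbs_of_forall_le hu, ?_⟩
  have haffine : p.dualObjective ((1 - t) • g + t • p.expectation p.P) u =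
      (1 - t) * p.dualObjective g u + t * p.dualObjective (p.expectation p.P) u := by
    simp only [dualObjective, LinearMap.add_apply, LinearMap.smul_apply, smul_eq_mul]
    ring
  rw [freeEnergy_gibbs_of_forall_le hu, haffine]
  exact add_le_add (mul_le_mul_of_nonneg_left (hb u) (sub_nonneg.2 ht.2.le))
    (mul_le_mul_of_nonneg_left (dualObjective_le_freeEnergy hPP u) ht.1.le)

lemma trace_le_freeEnergy_add (hΓ : p.IsFeasible g Γ) : Γ.trace.re ≤
    freeEnergy p.ε p.H Γ + p.ε * (gibbsState p.P p.ε p.H 1).trace.re := by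
  have h := le_freeEnergy p.isStarProjection_P p.ε_pos p.isHermitian_H isHermitian_one
    hΓ.posSemidef hΓ.compress_eq
  rw [Matrix.one_mul] at h
  linarith

open scoped Matrix.Norms.L2Operator in
/-- The free energy bounds the trace, so its sublevel sets are compact. -/
lemma exists_isFeasible_freeEnergy_le_of_tendsto {g' : ℕ → Module.Dual ℝ E}
    {G : ℕ → Matrix ι ι ℂ} {b' : ℕ → ℝ} {b : ℝ} (hG : ∀ n, p.IsFeasible (g' n) (G n))
    (hb' : ∀ n, freeEnergy p.ε p.H (G n) ≤ b' n) (hg : ∀ u, Tendsto (g' · u) atTop (𝓝 (g u)))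
    (hb : Tendsto b' atTop (𝓝 b)) :
    ∃ Γ, p.IsFeasible g Γ ∧ freeEnergy p.ε p.H Γ ≤ b := by
  obtain ⟨B, hB⟩ := hb.bddAbove_range
  obtain ⟨Γ, hΓ, φ, hφ, hlim⟩ :=
    (isCompact_setOf_posSemidef_trace_le
      (B + p.ε * (gibbsState p.P p.ε p.H 1).trace.re)).tendsto_subseq fun n =>
      ⟨(hG n).posSemidef, (trace_le_freeEnergy_add (hG n)).trans
        (add_le_add_left ((hb' n).trans (hB ⟨n, rfl⟩)) _)⟩
  have hcompress : p.P * Γ * p.P = Γ := by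
    have hcont : Continuous fun X => p.P * X * p.P := by fun_prop
    refine tendsto_nhds_unique ((hcont.tendsto Γ).comp hlim) (hlim.congr fun n => ?_)
    exact (hG (φ n)).compress_eq.symm
  have hexpectation : p.expectation Γ = g := LinearMap.ext fun u =>
    tendsto_nhds_unique (((p.continuous_expectation u).tendsto Γ).comp hlim)
      (((hg u).comp hφ.tendsto_atTop).congr fun n => by
        rw [Function.comp_apply, Function.comp_apply, Function.comp_apply,
          (hG (φ n)).expectation_eq])
  have hfreeEnergy : Tendsto (freeEnergy p.ε p.H ∘ G ∘ φ) atTop (𝓝 (freeEnergy p.ε p.H Γ)) :=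
    (continuousOn_freeEnergy p.ε p.H Γ hΓ.1.1).tendsto.comp
      (tendsto_nhdsWithin_iff.2 ⟨hlim, .of_forall fun n => (hG (φ n)).posSemidef.1⟩)
  exact ⟨Γ, ⟨hΓ.1, hcompress, hexpectation⟩,
    le_of_tendsto_of_tendsto' hfreeEnergy (hb.comp hφ.tendsto_atTop) fun n => hb' (φ n)⟩

theorem exists_isLUB_dualObjective (hΓ : p.IsFeasible g Γ) :
    ∃ Γ', p.IsFeasible g Γ' ∧
      IsLUB (Set.range (p.dualObjective g)) (freeEnergy p.ε p.H Γ') := by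
  have hweak {X : Matrix ι ι ℂ} (hX : p.IsFeasible g X) :
      freeEnergy p.ε p.H X ∈ upperBounds (Set.range (p.dualObjective g)) :=
    Set.forall_mem_range.2 (dualObjective_le_freeEnergy hX)
  obtain ⟨b, hb⟩ : ∃ b, IsLUB (Set.range (p.dualObjective g)) b :=
    Real.exists_isLUB (Set.range_nonempty _) ⟨_, hweak hΓ⟩
  obtain ⟨t, -, ht, ht0⟩ := exists_seq_strictAnti_tendsto' (zero_lt_one (α := ℝ))
  have hmix (x y : ℝ) : Tendsto (fun n => (1 - t n) * x + t n * y) atTop (𝓝 x) := by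
    simpa using ((ht0.const_sub 1).mul_const x).add (ht0.mul_const y)
  choose G hG hGle using fun n =>
    exists_freeEnergy_le_add hΓ (fun u => hb.1 ⟨u, rfl⟩) (ht n)
  obtain ⟨Γ', hΓ', hle⟩ := exists_isFeasible_freeEnergy_le_of_tendsto hG hGle
    (fun u => hmix (g u) _) (hmix b _)
  exact ⟨Γ', hΓ', hweak hΓ', fun y hy => hle.trans (hb.2 hy)⟩

end StrongDuality

end EntropicProblem

section Permutations

variable {N d : ℕ}

namespace Statistics

lemma character_mul (s : Statistics) (σ τ : Equiv.Perm (Fin N)) :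
    s.character (σ * τ) = s.character σ * s.character τ := by
  cases s <;> simp [character]

lemma character_mul_self (s : Statistics) (σ : Equiv.Perm (Fin N)) :
    s.character σ * s.character σ = 1 := by
  cases s
  · simp [character]
  · rcases Int.units_eq_one_or (Equiv.Perm.sign σ) with h | h <;> simp [character, h]

lemma character_inv (s : Statistics) (σ : Equiv.Perm (Fin N)) :
    s.character σ⁻¹ = s.character σ := by
  cases s <;> simp [character]

lemma star_character (s : Statistics) (σ : Equiv.Perm (Fin N)) :
    star (s.character σ) = s.character σ := by
  cases s <;> simp [character]

end Statistics

/-- The permutation operator `(P_σ ψ) x = ψ (x ∘ σ)` on the `N`-fold tensor product. -/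
def permOp (d : ℕ) (σ : Equiv.Perm (Fin N)) : ManyBody N d :=
  Equiv.Perm.permMatrix ℂ (σ.symm.arrowCongr (Equiv.refl (Fin d)))

lemma permOp_mul_apply (σ : Equiv.Perm (Fin N)) (A : ManyBody N d) (x y : Fin N → Fin d) :
    (permOp d σ * A) x y = A (x ∘ σ) y := by
  rw [permOp, PEquiv.toMatrix_toPEquiv_mul]
  rfl

lemma mul_permOp_apply (σ : Equiv.Perm (Fin N)) (A : ManyBody N d) (x y : Fin N → Fin d) :
    (A * permOp d σ) x y = A x (y ∘ σ.symm) := by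
  rw [permOp, PEquiv.mul_toMatrix_toPEquiv]
  rfl

lemma permOp_mul (σ τ : Equiv.Perm (Fin N)) : permOp d σ * permOp d τ = permOp d (σ * τ) := by
  rw [permOp, permOp, ← permMatrix_mul]
  rfl

lemma permOp_conjTranspose (σ : Equiv.Perm (Fin N)) : (permOp d σ)ᴴ = permOp d σ⁻¹ := by
  rw [permOp, conjTranspose_permMatrix]
  rfl

lemma permOp_mul_conjTranspose (σ : Equiv.Perm (Fin N)) : permOp d σ * (permOp d σ)ᴴ = 1 := by
  rw [permOp_conjTranspose, permOp_mul, mul_inv_cancel]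
  exact permMatrix_one

lemma symProj_eq_sum (s : Statistics) (N d : ℕ) :
    symProj s N d =
      ((N.factorial : ℂ))⁻¹ • ∑ σ : Equiv.Perm (Fin N), s.character σ • permOp d σ := by
  ext x y
  simp only [symProj, of_apply, Matrix.smul_apply, Matrix.sum_apply, permOp,
    PEquiv.toMatrix_apply, smul_eq_mul, mul_ite, mul_one, mul_zero]
  simp [Equiv.arrowCongr, eq_comm]

lemma symProj_mul_apply (s : Statistics) (A : ManyBody N d) (x y : Fin N → Fin d) :
    (symProj s N d * A) x y = ((N.factorial : ℂ))⁻¹ *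
      ∑ σ : Equiv.Perm (Fin N), s.character σ * A (x ∘ σ) y := by
  simp only [symProj_eq_sum, Matrix.smul_mul, Matrix.sum_mul, Matrix.smul_apply, Matrix.sum_apply,
    permOp_mul_apply, smul_eq_mul]

lemma permOp_mul_symProj (s : Statistics) (τ : Equiv.Perm (Fin N)) :
    permOp d τ * symProj s N d = s.character τ • symProj s N d := by
  rw [symProj_eq_sum, Matrix.mul_smul, smul_comm]
  congr 1
  rw [Matrix.mul_sum, Finset.smul_sum]
  refine Fintype.sum_equiv (Equiv.mulLeft τ) _ _ fun σ => ?_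
  rw [Matrix.mul_smul, permOp_mul, Equiv.coe_mulLeft, s.character_mul, smul_smul, ← mul_assoc,
    s.character_mul_self, one_mul]

lemma isStarProjection_symProj (s : Statistics) (N d : ℕ) : IsStarProjection (symProj s N d) where
  isIdempotentElem := by
    have hterm : ∀ σ : Equiv.Perm (Fin N),
        (s.character σ • permOp d σ) * symProj s N d = symProj s N d := fun σ => by
      rw [Matrix.smul_mul, permOp_mul_symProj, smul_smul, s.character_mul_self, one_smul]
    have hfact : (N.factorial : ℂ) ≠ 0 := by exact_mod_cast N.factorial_ne_zero
    rw [IsIdempotentElem]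
    conv_lhs => enter [1]; rw [symProj_eq_sum]
    rw [Matrix.smul_mul, Matrix.sum_mul, Finset.sum_congr rfl fun σ _ => hterm σ,
      Finset.sum_const, Finset.card_univ, Fintype.card_perm, Fintype.card_fin,
      ← Nat.cast_smul_eq_nsmul ℂ, inv_smul_smul₀ hfact]
  isSelfAdjoint := by
    rw [IsSelfAdjoint, star_eq_conjTranspose, symProj_eq_sum, conjTranspose_smul,
      conjTranspose_sum, star_inv₀, star_natCast]
    congr 1
    refine Fintype.sum_equiv (Equiv.inv _) _ _ fun σ => ?_
    rw [conjTranspose_smul, permOp_conjTranspose, s.star_character, Equiv.inv_apply,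
      s.character_inv]

lemma commute_symProj (s : Statistics) {A : ManyBody N d} (hA : ∀ σ, Commute (permOp d σ) A) :
    Commute (symProj s N d) A := by
  rw [symProj_eq_sum]
  exact (Commute.sum_left Finset.univ _ A fun σ _ => (hA σ).smul_left _).smul_left _

/-- The two signs produced by an operator on a symmetry sector cancel. -/
lemma permOp_conj_of_compress_eq {s : Statistics} {Γ : ManyBody N d} (hΓ : compress s Γ = Γ)
    (σ : Equiv.Perm (Fin N)) : permOp d σ * Γ * (permOp d σ)ᴴ = Γ := by
  have hright : symProj s N d * (permOp d σ)ᴴ = s.character σ • symProj s N d := by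
    have h := congrArg conjTranspose (permOp_mul_symProj (d := d) s σ)
    rwa [conjTranspose_mul, conjTranspose_smul, s.star_character, ← star_eq_conjTranspose,
      (isStarProjection_symProj s N d).isSelfAdjoint.star_eq] at h
  conv_lhs => rw [← hΓ]
  rw [compress, Matrix.mul_assoc, Matrix.mul_assoc _ _ (permOp d σ)ᴴ, hright,
    ← Matrix.mul_assoc, ← Matrix.mul_assoc, permOp_mul_symProj, Matrix.mul_smul, Matrix.smul_mul,
    Matrix.smul_mul, smul_smul, s.character_mul_self, one_smul]
  exact hΓ

end Permutations

section TensorPowers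

variable {N d : ℕ}

/-- The tensor product `A 0 ⊗ ⋯ ⊗ A (N - 1)`. -/
def tensorOp (A : Fin N → OneBody d) : ManyBody N d :=
  Matrix.of fun x y => ∏ i, A i (x i) (y i)

lemma tensorOp_mul (A B : Fin N → OneBody d) : tensorOp A * tensorOp B = tensorOp (A * B) := by
  ext x z
  simp only [tensorOp, Matrix.mul_apply, of_apply, ← Finset.prod_mul_distrib, Pi.mul_apply]
  rw [Finset.prod_univ_sum, Fintype.piFinset_univ]

lemma tensorOp_conjTranspose (A : Fin N → OneBody d) : (tensorOp A)ᴴ = tensorOp (star A) := by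
  ext x y
  simp [tensorOp]

lemma tensorOp_one : tensorOp (1 : Fin N → OneBody d) = 1 := by
  ext x y
  simp only [tensorOp, of_apply, Pi.one_apply, Matrix.one_apply, Finset.prod_ite_zero,
    Finset.prod_const_one, Finset.mem_univ, true_imp_iff, funext_iff]

lemma siteOp_eq_tensorOp (i : Fin N) (A : OneBody d) :
    siteOp i A = tensorOp (Pi.mulSingle i A) := by
  ext x y
  simp only [siteOp, tensorOp, of_apply]
  rw [← Finset.mul_prod_erase Finset.univ _ (Finset.mem_univ i), Pi.mulSingle_eq_same]
  congr 1
  refine Finset.prod_congr rfl fun j hj => ?_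
  rw [Pi.mulSingle_eq_of_ne (Finset.ne_of_mem_erase hj), Matrix.one_apply]

lemma permOp_mul_tensorOp (σ : Equiv.Perm (Fin N)) (A : Fin N → OneBody d) :
    permOp d σ * tensorOp A = tensorOp (A ∘ σ.symm) * permOp d σ := by
  ext x y
  rw [permOp_mul_apply, mul_permOp_apply]
  exact Fintype.prod_equiv σ _ _ fun i => by simp

lemma permOp_mul_siteOp (σ : Equiv.Perm (Fin N)) (i : Fin N) (A : OneBody d) :
    permOp d σ * siteOp i A = siteOp (σ i) A * permOp d σ := by
  rw [siteOp_eq_tensorOp, siteOp_eq_tensorOp, permOp_mul_tensorOp]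
  congr 2
  funext j
  simp [Pi.mulSingle_apply, Equiv.symm_apply_eq]

lemma siteOp_one (i : Fin N) : siteOp i (1 : OneBody d) = 1 := by
  rw [siteOp_eq_tensorOp, Pi.mulSingle_one, tensorOp_one]

lemma siteOp_conjTranspose (i : Fin N) (A : OneBody d) : (siteOp i A)ᴴ = siteOp i Aᴴ := by
  rw [siteOp_eq_tensorOp, siteOp_eq_tensorOp, tensorOp_conjTranspose]
  congr 1
  funext j
  rcases eq_or_ne j i with rfl | h <;> simp [*, star_eq_conjTranspose]

lemma siteOp_conj_tensorOp (i : Fin N) (A : OneBody d) {W : OneBody d} (hW : Wᴴ * W = 1) :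
    (tensorOp fun _ : Fin N => W)ᴴ * siteOp i A * tensorOp (fun _ => W) =
      siteOp i (Wᴴ * A * W) := by
  rw [siteOp_eq_tensorOp, siteOp_eq_tensorOp, tensorOp_conjTranspose, tensorOp_mul, tensorOp_mul]
  congr 1
  funext j
  rcases eq_or_ne j i with rfl | h <;> simp [*, star_eq_conjTranspose]

variable (N d) in
/-- The Kronecker sum as a linear map. -/
def kroneckerSumHom : OneBody d →ₗ[ℂ] ManyBody N d where
  toFun := kroneckerSum N
  map_add' A B := by
    ext x y
    simp [kroneckerSum, siteOp, Matrix.sum_apply, add_mul, Finset.sum_add_distrib]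
  map_smul' c A := by
    ext x y
    simp [kroneckerSum, siteOp, Matrix.sum_apply, mul_assoc, Finset.mul_sum]

lemma kroneckerSum_one : kroneckerSum N (1 : OneBody d) = (N : ℂ) • 1 := by
  simp [kroneckerSum, siteOp_one, Nat.cast_smul_eq_nsmul]

lemma isHermitian_kroneckerSum {A : OneBody d} (hA : A.IsHermitian) :
    (kroneckerSum N A).IsHermitian := by
  rw [Matrix.IsHermitian, kroneckerSum, conjTranspose_sum]
  simp only [siteOp_conjTranspose, hA.eq]

lemma commute_symProj_kroneckerSum (s : Statistics) (A : OneBody d) :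
    Commute (symProj s N d) (kroneckerSum N A) :=
  commute_symProj s fun σ => by
    rw [Commute, SemiconjBy, kroneckerSum, Matrix.mul_sum, Matrix.sum_mul]
    exact Fintype.sum_equiv σ _ _ fun i => permOp_mul_siteOp σ i A

lemma compress_kroneckerSum (s : Statistics) (A : OneBody d) :
    compress s (kroneckerSum N A) = symProj s N d * kroneckerSum N A := by
  rw [compress, (commute_symProj_kroneckerSum s A).eq, Matrix.mul_assoc,
    (isStarProjection_symProj s N d).isIdempotentElem.eq]

lemma kroneckerSum_apply_self (A : OneBody d) (x : Fin N → Fin d) :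
    kroneckerSum N A x x = ∑ i, A (x i) (x i) := by
  simp [kroneckerSum, siteOp, Matrix.sum_apply]

end TensorPowers

section Marginals

variable {N d : ℕ} {s : Statistics} {γ : OneBody d} {Γ : ManyBody N d}

lemma HasMarginals.trace_kroneckerSum (h : HasMarginals Γ γ) (A : OneBody d) :
    (Γ * kroneckerSum N A).trace = N * (γ * A).trace := by
  rw [kroneckerSum, Matrix.mul_sum, Matrix.trace_sum, Finset.sum_congr rfl fun i _ => (h i A).symm]
  simp

lemma trace_mul_siteOp_eq (hΓ : compress s Γ = Γ) (i j : Fin N) (A : OneBody d) :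
    (Γ * siteOp i A).trace = (Γ * siteOp j A).trace := by
  set σ := Equiv.swap j i
  calc (Γ * siteOp i A).trace
      = (permOp d σ * Γ * (permOp d σ)ᴴ * siteOp i A).trace := by
        rw [permOp_conj_of_compress_eq hΓ]
    _ = (Γ * (permOp d σ)ᴴ * (siteOp (σ j) A * permOp d σ)).trace := by
        rw [Equiv.swap_apply_left, Matrix.mul_assoc, Matrix.mul_assoc, Matrix.trace_mul_comm]
        simp only [Matrix.mul_assoc]
    _ = (Γ * siteOp j A).trace := by
        rw [← permOp_mul_siteOp, ← Matrix.mul_assoc, Matrix.mul_assoc Γ,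
          mul_eq_one_comm.1 (permOp_mul_conjTranspose σ), Matrix.mul_one]

lemma hasMarginals_of_trace_kroneckerSum (hΓ : compress s Γ = Γ)
    (h : ∀ A, (Γ * kroneckerSum N A).trace = N * (γ * A).trace) : HasMarginals Γ γ := by
  intro i A
  have hN : (N : ℂ) ≠ 0 := Nat.cast_ne_zero.2 i.pos.ne'
  have hsum := h A
  rw [kroneckerSum, Matrix.mul_sum, Matrix.trace_sum,
    Finset.sum_congr rfl fun j _ => trace_mul_siteOp_eq hΓ j i A, Finset.sum_const,
    Finset.card_univ, Fintype.card_fin, nsmul_eq_mul] at hsum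
  exact (mul_left_cancel₀ hN hsum).symm

end Marginals

section SectorProblem

lemma ofReal_re_trace_mul {ι : Type*} [Fintype ι] {A B : Matrix ι ι ℂ} (hA : A.IsHermitian)
    (hB : B.IsHermitian) : ((A * B).trace.re : ℂ) = (A * B).trace := by
  refine Complex.conj_eq_iff_re.1 ?_
  rw [← Complex.star_def, ← trace_conjTranspose, conjTranspose_mul, hA.eq, hB.eq,
    Matrix.trace_mul_comm]

variable {N d : ℕ} {s : Statistics} {ε : ℝ} {H Γ : ManyBody N d} {γ : OneBody d}

/-- The duality problem in a symmetry sector: the observables are the averages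
`N⁻¹ (U ⊕ ⋯ ⊕ U)` over the particles, labelled by the Hermitian matrices `U`. -/
noncomputable def sectorProblem (s : Statistics) (hε : 0 < ε) (hH : H.IsHermitian) :
    EntropicProblem (Fin N → Fin d) (selfAdjoint.submodule ℝ (OneBody d)) where
  ε := ε
  ε_pos := hε
  H := H
  isHermitian_H := hH
  P := symProj s N d
  isStarProjection_P := isStarProjection_symProj s N d
  K := ((N : ℂ)⁻¹ • kroneckerSumHom N d).restrictScalars ℝ ∘ₗ Submodule.subtype _
  isHermitian_K U :=
    IsHermitian.smul (k := (N : ℂ)⁻¹) (isHermitian_kroneckerSum U.2) (IsSelfAdjoint.natCast N).inv₀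

/-- The expectations in the state `γ`, as a functional of the Hermitian observable. -/
noncomputable def hermitianPairing (γ : OneBody d) :
    Module.Dual ℝ (selfAdjoint.submodule ℝ (OneBody d)) where
  toFun U := ((U : OneBody d) * γ).trace.re
  map_add' U V := by simp [Matrix.add_mul]
  map_smul' c U := by simp

lemma primalEnergy_eq_freeEnergy_add (hΓ : IsDensity Γ) :
    primalEnergy ε H Γ = freeEnergy ε H Γ + ε := by
  rw [primalEnergy, freeEnergy, hΓ.2, Complex.one_re]
  ring

lemma sectorProblem_expectation_apply (hε : 0 < ε) (hH : H.IsHermitian)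
    (U : selfAdjoint.submodule ℝ (OneBody d)) : (sectorProblem s hε hH).expectation Γ U =
      ((N : ℂ)⁻¹ * (Γ * kroneckerSum N (U : OneBody d)).trace).re := by
  rw [← smul_eq_mul, ← trace_smul, ← Matrix.mul_smul, Matrix.trace_mul_comm]
  rfl

lemma HasMarginals.expectation_eq (hN : N ≠ 0) (hε : 0 < ε) (hH : H.IsHermitian)
    (hΓ : HasMarginals Γ γ) :
    (sectorProblem s hε hH).expectation Γ = hermitianPairing γ := by
  ext U
  rw [sectorProblem_expectation_apply, hΓ.trace_kroneckerSum,
    inv_mul_cancel_left₀ (Nat.cast_ne_zero.2 hN), Matrix.trace_mul_comm]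
  rfl

lemma hasMarginals_of_expectation_eq (hN : N ≠ 0) (hε : 0 < ε) (hH : H.IsHermitian)
    (hΓ : Γ.IsHermitian) (hγ : γ.IsHermitian) (hcompress : compress s Γ = Γ)
    (h : (sectorProblem s hε hH).expectation Γ = hermitianPairing γ) : HasMarginals Γ γ := by
  have hN' : (N : ℂ) ≠ 0 := Nat.cast_ne_zero.2 hN
  have hselfAdjoint (U : selfAdjoint.submodule ℝ (OneBody d)) :
      (Γ * kroneckerSum N (U : OneBody d)).trace = N * (γ * U).trace := by
    have hre : (N : ℝ)⁻¹ * (Γ * kroneckerSum N (U : OneBody d)).trace.re =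
        ((U : OneBody d) * γ).trace.re := by
      rw [← Complex.re_ofReal_mul, Complex.ofReal_inv, Complex.ofReal_natCast,
        ← sectorProblem_expectation_apply hε hH, h]
      rfl
    rw [← ofReal_re_trace_mul hΓ (isHermitian_kroneckerSum U.2), Matrix.trace_mul_comm γ,
      ← ofReal_re_trace_mul U.2 hγ, ← hre]
    push_cast
    rw [mul_inv_cancel_left₀ hN']
  have hlin : traceLinearMap (Fin N → Fin d) ℂ ℂ ∘ₗ LinearMap.mulLeft ℂ Γ ∘ₗ kroneckerSumHom N d =
      (N : ℂ) • traceLinearMap (Fin d) ℂ ℂ ∘ₗ LinearMap.mulLeft ℂ γ :=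
    LinearMap.ext_on span_selfAdjoint fun U hU => hselfAdjoint ⟨U, hU⟩
  exact hasMarginals_of_trace_kroneckerSum hcompress (LinearMap.congr_fun hlin)

lemma HasMarginals.trace_eq (hN : 1 ≤ N) (h : HasMarginals Γ γ) : Γ.trace = γ.trace := by
  simpa [siteOp_one] using (h ⟨0, hN⟩ 1).symm

lemma isAdmissible_iff_isFeasible (hN : 1 ≤ N) (hε : 0 < ε) (hH : H.IsHermitian)
    (hγ : IsDensity γ) :
    IsAdmissible s γ Γ ↔ (sectorProblem s hε hH).IsFeasible (hermitianPairing γ) Γ := by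
  have hN' : N ≠ 0 := Nat.one_le_iff_ne_zero.1 hN
  constructor
  · rintro ⟨⟨hdensity, hcompress⟩, hmarginals⟩
    exact ⟨hdensity.1, hcompress, hmarginals.expectation_eq hN' hε hH⟩
  · rintro ⟨hpos, hcompress, hexpectation⟩
    have hmarginals :=
      hasMarginals_of_expectation_eq hN' hε hH hpos.1 hγ.1.1 hcompress hexpectation
    exact ⟨⟨⟨hpos, (hmarginals.trace_eq hN).trans hγ.2⟩, hcompress⟩, hmarginals⟩

theorem dualityHolds_of_isAdmissible (hN : 1 ≤ N) (hε : 0 < ε) (hH : H.IsHermitian)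
    (hγ : IsDensity γ) (hΓ : IsAdmissible s γ Γ) : DualityHolds s ε H γ := by
  obtain ⟨Γ₀, hΓ₀, hlub⟩ := EntropicProblem.exists_isLUB_dualObjective
    ((isAdmissible_iff_isFeasible hN hε hH hγ).1 hΓ)
  have hadm : IsAdmissible s γ Γ₀ := (isAdmissible_iff_isFeasible hN hε hH hγ).2 hΓ₀
  have hweak : dualValue s ε H γ ≤ primalValue s ε H γ := by
    refine iSup₂_le fun U hU => le_iInf₂ fun Γ' hΓ' => EReal.coe_le_coe_iff.2 ?_
    rw [primalEnergy_eq_freeEnergy_add hΓ'.1.1]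
    exact add_le_add_left (EntropicProblem.dualObjective_le_freeEnergy
      ((isAdmissible_iff_isFeasible hN hε hH hγ).1 hΓ') ⟨U, hU⟩) ε
  have hprimal : primalValue s ε H γ ≤ (primalEnergy ε H Γ₀ : EReal) := iInf₂_le Γ₀ hadm
  have hdual : (primalEnergy ε H Γ₀ : EReal) ≤ dualValue s ε H γ := by
    refine EReal.le_of_forall_lt_iff_le.1 fun b hb => EReal.coe_le_coe_iff.2 ?_
    rw [primalEnergy_eq_freeEnergy_add hadm.1.1, ← le_sub_iff_add_le]
    refine hlub.2 (Set.forall_mem_range.2 fun U => le_sub_iff_add_le.2 ?_)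
    have hU : (dualFunctional s ε H γ U : EReal) ≤ dualValue s ε H γ :=
      le_iSup₂_of_le (U : OneBody d) U.2 le_rfl
    exact EReal.coe_le_coe_iff.1 (hU.trans hb.le)
  exact ⟨le_antisymm (hprimal.trans hdual) hweak, _, le_antisymm hprimal (hdual.trans hweak)⟩

lemma isDualMaximiser_iff (hε : 0 < ε) (hH : H.IsHermitian)
    (U : selfAdjoint.submodule ℝ (OneBody d)) :
    IsDualMaximiser s ε H γ U ↔ ∀ V, (sectorProblem s hε hH).dualObjective (hermitianPairing γ) V ≤
      (sectorProblem s hε hH).dualObjective (hermitianPairing γ) U :=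
  ⟨fun h V => (add_le_add_iff_right ε).1 (h.2 V V.2),
    fun h => ⟨U.2, fun V hV => (add_le_add_iff_right ε).2 (h ⟨V, hV⟩)⟩⟩

lemma isPrimalMinimiser_iff_eq_gibbs (hN : 1 ≤ N) (hε : 0 < ε) (hH : H.IsHermitian)
    (hγ : IsDensity γ) {U : OneBody d} (hU : IsDualMaximiser s ε H γ U) :
    IsPrimalMinimiser s ε H γ Γ ↔ Γ = gibbs s ε H U := by
  lift U to selfAdjoint.submodule ℝ (OneBody d) using hU.1
  have hmax := (isDualMaximiser_iff hε hH U).1 hU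
  have hiff {X : ManyBody N d} := isAdmissible_iff_isFeasible (s := s) (Γ := X) hN hε hH hγ
  have hgibbs : IsAdmissible s γ (gibbs s ε H U) :=
    hiff.2 (EntropicProblem.isFeasible_gibbs_of_forall_le hmax)
  have henergy := EntropicProblem.freeEnergy_gibbs_of_forall_le hmax
  have hlower {X : ManyBody N d} (hX : IsAdmissible s γ X) :
      primalEnergy ε H (gibbs s ε H U) ≤ primalEnergy ε H X := by
    rw [primalEnergy_eq_freeEnergy_add hX.1.1, primalEnergy_eq_freeEnergy_add hgibbs.1.1]
    exact add_le_add_left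
      (henergy.trans_le (EntropicProblem.dualObjective_le_freeEnergy (hiff.1 hX) U)) ε
  refine ⟨fun h => ?_, fun h => h ▸ ⟨hgibbs, fun X => hlower⟩⟩
  refine (EntropicProblem.freeEnergy_eq_dualObjective_iff (hiff.1 h.1)).1 (Eq.trans ?_ henergy)
  have heq := le_antisymm (h.2 _ hgibbs) (hlower h.1)
  rwa [primalEnergy_eq_freeEnergy_add h.1.1.1, primalEnergy_eq_freeEnergy_add hgibbs.1.1,
    add_left_inj] at heq

lemma injective_compress_observable (hN : 1 ≤ N) (hε : 0 < ε) (hH : H.IsHermitian)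
    (hinj : ∀ W : OneBody d, W.IsHermitian → compress s (kroneckerSum N W) = 0 → W = 0) :
    Function.Injective fun U => (sectorProblem s hε hH).P * (sectorProblem s hε hH).K U *
      (sectorProblem s hε hH).P := by
  let L := LinearMap.mulRight ℝ (symProj s N d) ∘ₗ LinearMap.mulLeft ℝ (symProj s N d) ∘ₗ
    (sectorProblem s hε hH).K
  refine (injective_iff_map_eq_zero L).2 fun U hU => Subtype.ext (hinj U U.2 ?_)
  have hN' : (N : ℂ)⁻¹ ≠ 0 := inv_ne_zero (Nat.cast_ne_zero.2 (Nat.one_le_iff_ne_zero.1 hN))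
  refine (smul_eq_zero_iff_right hN').1 ?_
  rw [compress, ← Matrix.smul_mul, ← Matrix.mul_smul]
  exact hU

theorem uniqueOptimisers_of_isFaithful (hN : 1 ≤ N) (hε : 0 < ε) (hH : H.IsHermitian)
    (hγ : IsDensity γ) (hΓ : IsAdmissible s γ Γ) (hfaithful : (sectorProblem s hε hH).IsFaithful Γ)
    (hinj : ∀ W : OneBody d, W.IsHermitian → compress s (kroneckerSum N W) = 0 → W = 0) :
    UniqueOptimisers s ε H γ := by
  obtain ⟨U, hU⟩ := EntropicProblem.exists_forall_dualObjective_le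
    ((isAdmissible_iff_isFeasible hN hε hH hγ).1 hΓ) hfaithful
  have hmax : IsDualMaximiser s ε H γ U := (isDualMaximiser_iff hε hH U).2 hU
  refine ⟨U, hmax, fun V hV => ?_, (isPrimalMinimiser_iff_eq_gibbs hN hε hH hγ hmax).2 rfl,
    fun Γ' => (isPrimalMinimiser_iff_eq_gibbs hN hε hH hγ hmax).1⟩
  lift V to selfAdjoint.submodule ℝ (OneBody d) using hV.1
  exact congrArg Subtype.val (EntropicProblem.eq_of_forall_dualObjective_le
    (injective_compress_observable hN hε hH hinj) ((isDualMaximiser_iff hε hH V).1 hV) hU)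

end SectorProblem

section Representability

variable {N d : ℕ} {s : Statistics}

/-- The density matrices on `ℂ^d` that are the one-particle marginal of a state of `N` bosons or
fermions. -/
def representable (s : Statistics) (N d : ℕ) : Set (OneBody d) :=
  {γ | ∃ Γ : ManyBody N d, IsAdmissible s γ Γ}

lemma convex_setOf_isAdmissible (s : Statistics) (N d : ℕ) :
    Convex ℝ {p : OneBody d × ManyBody N d | IsAdmissible s p.1 p.2} := by
  rintro ⟨γ₁, Γ₁⟩ ⟨⟨⟨hpos₁, htrace₁⟩, hcompress₁⟩, hmarginals₁⟩ ⟨γ₂, Γ₂⟩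
    ⟨⟨⟨hpos₂, htrace₂⟩, hcompress₂⟩, hmarginals₂⟩ a b ha hb hab
  simp only at hpos₁ htrace₁ hcompress₁ hmarginals₁ hpos₂ htrace₂ hcompress₂ hmarginals₂
  refine ⟨⟨⟨(hpos₁.smul ha).add (hpos₂.smul hb), ?_⟩, ?_⟩, fun i A => ?_⟩
  · simp only [Prod.snd_add, Prod.smul_snd, trace_add, trace_smul, htrace₁, htrace₂]
    rw [← add_smul, hab, one_smul]
  · rw [compress] at hcompress₁ hcompress₂ ⊢
    simp only [Prod.snd_add, Prod.smul_snd, Matrix.mul_add, Matrix.add_mul, Matrix.mul_smul,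
      Matrix.smul_mul, hcompress₁, hcompress₂]
  · simp only [Prod.fst_add, Prod.snd_add, Prod.smul_fst, Prod.smul_snd, Matrix.add_mul,
      Matrix.smul_mul, trace_add, trace_smul]
    rw [hmarginals₁ i A, hmarginals₂ i A]

lemma convex_representable (s : Statistics) (N d : ℕ) : Convex ℝ (representable s N d) := by
  rintro γ₁ ⟨Γ₁, hΓ₁⟩ γ₂ ⟨Γ₂, hΓ₂⟩ a b ha hb hab
  exact ⟨a • Γ₁ + b • Γ₂, convex_setOf_isAdmissible s N d (x := (γ₁, Γ₁)) hΓ₁ (y := (γ₂, Γ₂)) hΓ₂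
    ha hb hab⟩

lemma conj_mem_representable {γ W : OneBody d} (hW : Wᴴ * W = 1) (hγ : γ ∈ representable s N d) :
    W * γ * Wᴴ ∈ representable s N d := by
  obtain ⟨Γ, ⟨⟨hpos, htrace⟩, hcompress⟩, hmarginals⟩ := hγ
  set T : ManyBody N d := tensorOp fun _ => W with hT
  have hTT : Tᴴ * T = 1 := by
    rw [hT, tensorOp_conjTranspose, tensorOp_mul, ← tensorOp_one]
    congr 1
    exact funext fun _ => hW
  have hcomm : Commute (symProj s N d) T :=
    commute_symProj s fun σ => permOp_mul_tensorOp σ _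
  have hcomm' : Commute (symProj s N d) Tᴴ := by
    simpa only [(isStarProjection_symProj s N d).isSelfAdjoint.star_eq, star_eq_conjTranspose]
      using hcomm.star_star
  refine ⟨T * Γ * Tᴴ, ⟨⟨hpos.mul_mul_conjTranspose_same T, ?_⟩, ?_⟩, fun i A => ?_⟩
  · rw [trace_mul_cycle, hTT, Matrix.one_mul, htrace]
  · calc compress s (T * Γ * Tᴴ) = T * compress s Γ * Tᴴ := by
          simp only [compress, Matrix.mul_assoc, ← hcomm'.eq]
          simp only [← Matrix.mul_assoc, hcomm.eq]
      _ = T * Γ * Tᴴ := by rw [hcompress]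
  · calc (W * γ * Wᴴ * A).trace = (γ * (Wᴴ * A * W)).trace := by
          rw [Matrix.mul_assoc, Matrix.mul_assoc, Matrix.trace_mul_comm]
          simp only [Matrix.mul_assoc]
      _ = (Γ * (Tᴴ * siteOp i A * T)).trace := by
          rw [hmarginals i, siteOp_conj_tensorOp i A hW]
      _ = (T * Γ * Tᴴ * siteOp i A).trace := by
          rw [Matrix.mul_assoc (T * Γ), Matrix.mul_assoc T, Matrix.trace_mul_comm T]
          simp only [Matrix.mul_assoc]

lemma mem_representable_of_diagonal_eigenvalues_mem {γ : OneBody d} (hγ : γ.IsHermitian)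
    (h : (diagonal fun a => (hγ.eigenvalues a : ℂ)) ∈ representable s N d) :
    γ ∈ representable s N d := by
  have hunitary : (hγ.eigenvectorUnitary : OneBody d)ᴴ * hγ.eigenvectorUnitary = 1 :=
    Unitary.coe_star_mul_self hγ.eigenvectorUnitary
  have hspectral : γ = hγ.eigenvectorUnitary * (diagonal fun a => (hγ.eigenvalues a : ℂ)) *
      (hγ.eigenvectorUnitary : OneBody d)ᴴ := hγ.spectral_theorem
  rw [hspectral]
  exact conj_mem_representable hunitary h

end Representability

section Occupation

variable {N d : ℕ} {s : Statistics}

/-- The occupation numbers of the product state `e_{x 0} ⊗ ⋯ ⊗ e_{x (N - 1)}`, normalised to have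
sum one. -/
noncomputable def occupation (x : Fin N → Fin d) : Fin d → ℝ :=
  (N : ℝ)⁻¹ • ∑ i, Pi.single (x i) 1

lemma trace_diagonal_occupation_mul (hN : 1 ≤ N) (x : Fin N → Fin d) (A : OneBody d) :
    N * ((diagonal fun a => (occupation x a : ℂ)) * A).trace = kroneckerSum N A x x := by
  have hN' : (N : ℂ) ≠ 0 := Nat.cast_ne_zero.2 (Nat.one_le_iff_ne_zero.1 hN)
  calc N * ((diagonal fun a => (occupation x a : ℂ)) * A).trace
      = ∑ a, (∑ i, if a = x i then 1 else 0) * A a a := by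
        rw [Matrix.trace, Finset.mul_sum]
        refine Finset.sum_congr rfl fun a _ => ?_
        rw [diag_apply, diagonal_mul, ← mul_assoc]
        simp [occupation, Pi.single_apply, hN']
    _ = ∑ i, A (x i) (x i) := by
        simp only [Finset.sum_mul]
        rw [Finset.sum_comm]
        simp
    _ = kroneckerSum N A x x := (kroneckerSum_apply_self A x).symm

/-- Projecting the product state `e_x` onto the symmetry sector and normalising gives a state with
the occupation numbers of `x`. -/
lemma diagonal_occupation_mem_representable (hN : 1 ≤ N) {x : Fin N → Fin d} {c : ℝ} (hc : 0 ≤ c)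
    (hx : ∀ A : OneBody d, c * compress s (kroneckerSum N A) x x = kroneckerSum N A x x) :
    (diagonal fun a => (occupation x a : ℂ)) ∈ representable s N d := by
  have hP := isStarProjection_symProj s N d
  set E : ManyBody N d := diagonal (Pi.single x 1) with hE
  have hEpos : E.PosSemidef := PosSemidef.diagonal fun y => by
    rw [Pi.single_apply]
    split_ifs <;> simp
  have htrace (M : ManyBody N d) : (E * M).trace = M x x := by
    simp [hE, Matrix.trace, Pi.single_apply]
  have hpos : (c • compress s E).PosSemidef := by
    have h := (hEpos.mul_mul_conjTranspose_same (symProj s N d)).smul hc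
    rwa [← star_eq_conjTranspose, hP.isSelfAdjoint.star_eq] at h
  have hcompress : compress s (c • compress s E) = c • compress s E := by
    rw [compress, Matrix.mul_smul, Matrix.smul_mul]
    exact congrArg _ (compress_compress hP E)
  have hmarginals : HasMarginals (c • compress s E) (diagonal fun a => (occupation x a : ℂ)) := by
    refine hasMarginals_of_trace_kroneckerSum hcompress fun A => ?_
    calc (c • compress s E * kroneckerSum N A).trace
        = c * (E * compress s (kroneckerSum N A)).trace := by
          rw [Matrix.smul_mul, trace_smul, Complex.real_smul, compress, Matrix.mul_assoc,
            Matrix.mul_assoc, Matrix.trace_mul_comm]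
          simp only [compress, Matrix.mul_assoc]
      _ = N * ((diagonal fun a => (occupation x a : ℂ)) * A).trace := by
          rw [htrace, hx, trace_diagonal_occupation_mul hN]
  refine ⟨_, ⟨⟨hpos, ?_⟩, hcompress⟩, hmarginals⟩
  have hone := trace_diagonal_occupation_mul hN x 1
  rw [kroneckerSum_one, Matrix.mul_one, Matrix.smul_apply, Matrix.one_apply_eq, smul_eq_mul] at hone
  rw [hmarginals.trace_eq hN]
  exact mul_left_cancel₀ (Nat.cast_ne_zero.2 (Nat.one_le_iff_ne_zero.1 hN)) hone

lemma diagonal_mem_representable_of_mem_convexHull {S : Set (Fin d → ℝ)}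
    (hS : ∀ l ∈ S, (diagonal fun a => (l a : ℂ)) ∈ representable s N d) {l : Fin d → ℝ}
    (hl : l ∈ convexHull ℝ S) : (diagonal fun a => (l a : ℂ)) ∈ representable s N d :=
  convexHull_min hS ((convex_representable s N d).linear_preimage
    (diagonalLinearMap (Fin d) ℝ ℂ ∘ₗ Complex.ofRealCLM.toLinearMap.compLeft (Fin d))) hl

lemma compress_kroneckerSum_apply_const (A : OneBody d) (a : Fin d) :
    compress .boson (kroneckerSum N A) (fun _ => a) (fun _ => a) =
      kroneckerSum N A (fun _ => a) (fun _ => a) := by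
  have hfact : (N.factorial : ℂ) ≠ 0 := Nat.cast_ne_zero.2 N.factorial_ne_zero
  rw [compress_kroneckerSum, symProj_mul_apply, inv_mul_eq_iff_eq_mul₀ hfact]
  simp [Statistics.character, Function.comp_def, Fintype.card_perm]

/-- A nontrivial permutation moves at least two particles, a one-body operator only one. -/
lemma kroneckerSum_comp_perm_apply (A : OneBody d) {x : Fin N → Fin d}
    (hx : Function.Injective x) {σ : Equiv.Perm (Fin N)} (hσ : σ ≠ 1) :
    kroneckerSum N A (x ∘ σ) x = 0 := by
  rw [kroneckerSum, Matrix.sum_apply]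
  refine Finset.sum_eq_zero fun i _ => ?_
  obtain ⟨j, hj, hji⟩ := Finset.exists_mem_ne (Equiv.Perm.one_lt_card_support_of_ne_one hσ) i
  rw [siteOp, of_apply, Finset.prod_eq_zero (Finset.mem_erase.2 ⟨hji, Finset.mem_univ j⟩)
    (if_neg fun h => Equiv.Perm.mem_support.1 hj (hx h)), mul_zero]

lemma compress_kroneckerSum_apply_of_injective (A : OneBody d) {x : Fin N → Fin d}
    (hx : Function.Injective x) :
    N.factorial * compress .fermion (kroneckerSum N A) x x = kroneckerSum N A x x := by
  have hfact : (N.factorial : ℂ) ≠ 0 := Nat.cast_ne_zero.2 N.factorial_ne_zero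
  rw [compress_kroneckerSum, symProj_mul_apply, mul_inv_cancel_left₀ hfact,
    Finset.sum_eq_single 1 (fun σ _ hσ => by rw [kroneckerSum_comp_perm_apply A hx hσ, mul_zero])
      (fun h => (h (Finset.mem_univ _)).elim)]
  simp [Statistics.character]

lemma occupation_const (hN : 1 ≤ N) (a : Fin d) :
    occupation (fun _ : Fin N => a) = Pi.single a 1 := by
  have hN' : (N : ℝ) ≠ 0 := Nat.cast_ne_zero.2 (Nat.one_le_iff_ne_zero.1 hN)
  rw [occupation, Finset.sum_const, Finset.card_univ, Fintype.card_fin, ← Nat.cast_smul_eq_nsmul ℝ,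
    inv_smul_smul₀ hN']

lemma exists_doublyStochastic_row_eq {k : ℕ} {l : Fin (N + k) → ℝ} (hnonneg : ∀ a, 0 ≤ l a)
    (hle : ∀ a, N * l a ≤ 1) (hsum : ∑ a, l a = 1) :
    ∃ M ∈ doublyStochastic ℝ (Fin (N + k)), ∀ i : Fin N, M (Fin.castAdd k i) = l := by
  have hdefect : ∑ a, (1 - N * l a) = k := by
    rw [Finset.sum_sub_distrib, ← Finset.mul_sum, hsum]
    simp
  have hcancel (a : Fin (N + k)) : (k : ℝ) * ((1 - N * l a) / k) = 1 - N * l a := by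
    refine mul_div_cancel_of_imp' fun hk => ?_
    rw [hk] at hdefect
    exact (Finset.sum_eq_zero_iff_of_nonneg fun a _ => sub_nonneg.2 (hle a)).1 hdefect a
      (Finset.mem_univ a)
  refine ⟨of (Fin.addCases (fun _ => l) fun _ a => (1 - N * l a) / k), ?_,
    fun i => funext fun a => by simp⟩
  rw [mem_doublyStochastic_iff_sum]
  refine ⟨fun i => ?_, fun i => ?_, fun a => ?_⟩
  · refine Fin.addCases (fun i a => ?_) (fun i a => ?_) i
    · simpa using hnonneg a
    · simpa using div_nonneg (sub_nonneg.2 (hle a)) k.cast_nonneg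
  · refine Fin.addCases (fun i => ?_) (fun i => ?_) i
    · simpa using hsum
    · have hk : (k : ℝ) ≠ 0 := Nat.cast_ne_zero.2 i.pos.ne'
      simp [← Finset.sum_div, hdefect, hk]
  · simp [Fin.sum_univ_add, hcancel]

/-- The case of a `0`-`1` vector is the row sum of a permutation matrix; the general case is
reduced to it by Birkhoff's theorem. -/
lemma mem_convexHull_occupation_of_injective (hN : 1 ≤ N) {l : Fin d → ℝ}
    (hnonneg : ∀ a, 0 ≤ l a) (hle : ∀ a, N * l a ≤ 1) (hsum : ∑ a, l a = 1) :
    l ∈ convexHull ℝ (occupation '' {x : Fin N → Fin d | Function.Injective x}) := by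
  have hN' : (N : ℝ) ≠ 0 := Nat.cast_ne_zero.2 (Nat.one_le_iff_ne_zero.1 hN)
  have hNd : (N : ℝ) ≤ d :=
    calc (N : ℝ) = ∑ a, N * l a := by rw [← Finset.mul_sum, hsum, mul_one]
      _ ≤ ∑ _a : Fin d, 1 := Finset.sum_le_sum fun a _ => hle a
      _ = d := by simp
  obtain ⟨k, rfl⟩ := Nat.exists_eq_add_of_le (Nat.cast_le.1 hNd)
  obtain ⟨M, hM, hrow⟩ := exists_doublyStochastic_row_eq hnonneg hle hsum
  let R : Matrix (Fin (N + k)) (Fin (N + k)) ℝ →ₗ[ℝ] Fin (N + k) → ℝ :=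
    { toFun := fun M a => (N : ℝ)⁻¹ * ∑ i, M (Fin.castAdd k i) a
      map_add' := fun A B => by
        ext a
        simp [Finset.sum_add_distrib, mul_add]
      map_smul' := fun c A => by
        ext a
        simp [← Finset.mul_sum, mul_left_comm] }
  have hRM : R M = l := by
    ext a
    simp [R, hrow, hN']
  have hRperm (σ : Equiv.Perm (Fin (N + k))) :
      R (σ.permMatrix ℝ) = occupation (σ ∘ Fin.castAdd k) := by
    ext a
    simp [R, occupation, PEquiv.toMatrix_apply, Pi.single_apply, eq_comm]
  rw [← SetLike.mem_coe, doublyStochastic_eq_convexHull_permMatrix] at hM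
  rw [← hRM]
  refine convexHull_mono ?_ (R.image_convexHull _ ▸ Set.mem_image_of_mem R hM)
  rintro _ ⟨_, ⟨σ, rfl⟩, rfl⟩
  exact ⟨σ ∘ Fin.castAdd k, σ.injective.comp (Fin.castAdd_injective N k), (hRperm σ).symm⟩

end Occupation

section Representability

open scoped MatrixOrder

variable {N d : ℕ} {γ : OneBody d}

lemma IsDensity.eigenvalues_mem_stdSimplex (hγ : IsDensity γ) :
    hγ.1.1.eigenvalues ∈ stdSimplex ℝ (Fin d) := by
  refine ⟨hγ.1.eigenvalues_nonneg, ?_⟩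
  exact Complex.ofReal_injective
    ((Complex.ofReal_sum _ _).trans (hγ.1.1.trace_eq_sum_eigenvalues.symm.trans hγ.2))

theorem mem_representable_boson (hN : 1 ≤ N) (hγ : IsDensity γ) :
    γ ∈ representable .boson N d := by
  refine mem_representable_of_diagonal_eigenvalues_mem hγ.1.1 ?_
  have hsimplex := hγ.eigenvalues_mem_stdSimplex
  rw [← convexHull_rangle_single_eq_stdSimplex] at hsimplex
  refine diagonal_mem_representable_of_mem_convexHull (Set.forall_mem_range.2 fun a => ?_) hsimplex
  rw [← occupation_const hN]
  exact diagonal_occupation_mem_representable hN zero_le_one fun A => by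
    rw [Complex.ofReal_one, one_mul, compress_kroneckerSum_apply_const]

theorem mem_representable_fermion (hN : 1 ≤ N) (hγ : IsDensity γ)
    (hpauli : ((N : ℂ)⁻¹ • (1 : OneBody d) - γ).PosSemidef) :
    γ ∈ representable .fermion N d := by
  have hN' : (0 : ℝ) < N := Nat.cast_pos.2 hN
  have hspectrum : ∀ t ∈ spectrum ℝ γ, t ≤ (N : ℝ)⁻¹ := by
    refine (le_algebraMap_iff_spectrum_le hγ.1.1).1 (Matrix.le_iff.2 ?_)
    have hscalar : algebraMap ℝ (OneBody d) (N : ℝ)⁻¹ = (N : ℂ)⁻¹ • 1 := by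
      rw [IsScalarTower.algebraMap_apply ℝ ℂ (OneBody d), Algebra.algebraMap_eq_smul_one]
      simp
    rwa [hscalar]
  have hle (a : Fin d) : N * hγ.1.1.eigenvalues a ≤ 1 :=
    (le_inv_mul_iff₀ hN').1 ((mul_one (N : ℝ)⁻¹).symm ▸
      hspectrum _ (hγ.1.1.eigenvalues_mem_spectrum_real a))
  obtain ⟨hnonneg, hsum⟩ := hγ.eigenvalues_mem_stdSimplex
  refine mem_representable_of_diagonal_eigenvalues_mem hγ.1.1
    (diagonal_mem_representable_of_mem_convexHull ?_
      (mem_convexHull_occupation_of_injective hN hnonneg hle hsum))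
  rintro _ ⟨x, hx, rfl⟩
  exact diagonal_occupation_mem_representable hN N.factorial.cast_nonneg fun A => by
    rw [Complex.ofReal_natCast, compress_kroneckerSum_apply_of_injective A hx]

end Representability

section Interior

open scoped MatrixOrder

open scoped Matrix.Norms.L2Operator in
lemma eventually_posSemidef_add_smul {ι : Type*} [Finite ι] {A E : Matrix ι ι ℂ} (hA : A.PosDef)
    (hE : E.IsHermitian) : ∀ᶠ τ : ℝ in 𝓝 0, (A + τ • E).PosSemidef := by
  classical
  have := Fintype.ofFinite ι
  rcases subsingleton_or_nontrivial (Matrix ι ι ℂ) with _ | _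
  · exact .of_forall fun τ => Subsingleton.elim 0 (A + τ • E) ▸ PosSemidef.zero
  obtain ⟨c, hc, hcA⟩ := (CFC.exists_pos_algebraMap_le_iff hA.1.isSelfAdjoint).2
    fun t ht => hA.isStrictlyPositive.spectrum_pos ht
  rw [Algebra.algebraMap_eq_smul_one, Matrix.le_iff] at hcA
  have htendsto : Tendsto (fun τ : ℝ => ‖τ • E‖) (𝓝 0) (𝓝 0) := by
    simpa using (continuous_id.smul (continuous_const (y := E))).norm.tendsto (0 : ℝ)
  filter_upwards [htendsto.eventually_le_const hc] with τ hτ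
  have h := (hcA.add (PosSemidef.one.smul (sub_nonneg.2 hτ))).add
    (posSemidef_norm_smul_one_add (IsHermitian.smul hE (IsSelfAdjoint.all τ)))
  have hsum : A - c • 1 + (c - ‖τ • E‖) • 1 + (‖τ • E‖ • 1 + τ • E) = A + τ • E := by
    rw [sub_smul]
    abel
  exact hsum ▸ h

variable {N d : ℕ} {s : Statistics} {γ : OneBody d} {Γ : ManyBody N d}

/-- `γ` is in the relative interior of the representable matrices: it can be moved inside this set
in every direction that preserves the trace and hermiticity. -/
def IsInteriorRepresentable (s : Statistics) (N : ℕ) {d : ℕ} (γ : OneBody d) : Prop :=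
  ∀ E : OneBody d, E.IsHermitian → E.trace = 0 →
    ∃ τ : ℝ, 0 < τ ∧ γ + τ • E ∈ representable s N d

lemma isInteriorRepresentable_of_eventually
    (h : ∀ E : OneBody d, E.IsHermitian → E.trace = 0 →
      ∀ᶠ τ : ℝ in 𝓝 0, γ + τ • E ∈ representable s N d) : IsInteriorRepresentable s N γ :=
  fun E hE htrace =>
    ((eventually_mem_nhdsWithin (s := Set.Ioi (0 : ℝ))).and
      ((h E hE htrace).filter_mono nhdsWithin_le_nhds)).exists

lemma isDensity_add_smul {E : OneBody d} {τ : ℝ} (hγ : IsDensity γ) (hE : E.trace = 0)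
    (hpos : (γ + τ • E).PosSemidef) : IsDensity (γ + τ • E) :=
  ⟨hpos, by rw [trace_add, trace_smul, hE, smul_zero, add_zero, hγ.2]⟩

theorem isInteriorRepresentable_boson (hN : 1 ≤ N) (hγ : IsDensity γ) (hpos : γ.PosDef) :
    IsInteriorRepresentable .boson N γ :=
  isInteriorRepresentable_of_eventually fun E hE htrace => by
    filter_upwards [eventually_posSemidef_add_smul hpos hE] with τ hτ
    exact mem_representable_boson hN (isDensity_add_smul hγ htrace hτ)

theorem isInteriorRepresentable_fermion (hN : 1 ≤ N) (hγ : IsDensity γ) (hpos : γ.PosDef)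
    (hpauli : ((N : ℂ)⁻¹ • (1 : OneBody d) - γ).PosDef) : IsInteriorRepresentable .fermion N γ :=
  isInteriorRepresentable_of_eventually fun E hE htrace => by
    filter_upwards [eventually_posSemidef_add_smul hpos hE,
      eventually_posSemidef_add_smul hpauli hE.neg] with τ hτ hτ'
    rw [smul_neg, ← sub_eq_add_neg, sub_sub] at hτ'
    exact mem_representable_fermion hN (isDensity_add_smul hγ htrace hτ) hτ'

lemma HasMarginals.isHermitian (hN : 1 ≤ N) (h : HasMarginals Γ γ) (hΓ : Γ.IsHermitian) :
    γ.IsHermitian := by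
  refine ext_iff_trace_mul_right.2 fun A => ?_
  calc (γᴴ * A).trace = star (γ * Aᴴ).trace := by
        rw [← trace_conjTranspose, conjTranspose_mul, conjTranspose_conjTranspose,
          Matrix.trace_mul_comm]
    _ = star (Γ * siteOp ⟨0, hN⟩ Aᴴ).trace := by rw [h]
    _ = (Γ * siteOp ⟨0, hN⟩ A).trace := by
        rw [← trace_conjTranspose, conjTranspose_mul, hΓ.eq, siteOp_conjTranspose,
          conjTranspose_conjTranspose, Matrix.trace_mul_comm]
    _ = (γ * A).trace := (h _ A).symm

lemma exists_trace_mul_eq {n R : Type*} [Fintype n] [CommSemiring R] (φ : Matrix n n R →ₗ[R] R) :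
    ∃ m : Matrix n n R, ∀ A, (m * A).trace = φ A := by
  classical
  refine ⟨of fun i j => φ (single j i 1), LinearMap.congr_fun (f := traceLinearMap n R R ∘ₗ
    LinearMap.mulLeft R (of fun i j => φ (single j i 1))) (ext_linearMap R fun i j => ?_)⟩
  ext
  simp [trace_mul_single]

lemma exists_hasMarginals (hN : 1 ≤ N) (hΓ : compress s Γ = Γ) :
    ∃ γ : OneBody d, HasMarginals Γ γ := by
  have hN' : (N : ℂ) ≠ 0 := Nat.cast_ne_zero.2 (Nat.one_le_iff_ne_zero.1 hN)
  obtain ⟨γ, hγ⟩ := exists_trace_mul_eq ((N : ℂ)⁻¹ • traceLinearMap (Fin N → Fin d) ℂ ℂ ∘ₗ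
    LinearMap.mulLeft ℂ Γ ∘ₗ kroneckerSumHom N d)
  refine ⟨γ, hasMarginals_of_trace_kroneckerSum hΓ fun A => ?_⟩
  rw [hγ, LinearMap.smul_apply, smul_eq_mul, mul_inv_cancel_left₀ hN']
  rfl

lemma IsSectorDensity.exists_smul_symProj (hΓ : IsSectorDensity s Γ) :
    ∃ t : ℝ, 0 < t ∧ IsSectorDensity s (t • symProj s N d) := by
  have hP := isStarProjection_symProj s N d
  have hpos := posSemidef_of_isStarProjection hP
  have hne : symProj s N d ≠ 0 := fun h => by
    have hzero : Γ = 0 := by rw [← hΓ.2, compress, h, Matrix.mul_zero]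
    simpa [hzero] using hΓ.1.2
  have htrace : 0 < (symProj s N d).trace :=
    hpos.trace_nonneg.lt_of_ne fun h => hne (hpos.trace_eq_zero_iff.1 h.symm)
  obtain ⟨r, hr⟩ : ∃ r : ℝ, (r : ℂ) = (symProj s N d).trace :=
    ⟨_, (Complex.eq_re_of_ofReal_le htrace.le).symm⟩
  rw [← hr, Complex.zero_lt_real] at htrace
  refine ⟨r⁻¹, inv_pos.2 htrace, ⟨hpos.smul (inv_nonneg.2 htrace.le), ?_⟩, ?_⟩
  · rw [trace_smul, ← hr, Complex.real_smul, ← Complex.ofReal_mul, inv_mul_cancel₀ htrace.ne',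
      Complex.ofReal_one]
  · rw [compress, Matrix.mul_smul, Matrix.smul_mul, hP.isIdempotentElem.eq,
      hP.isIdempotentElem.eq]

/-- Mix the state of a slightly displaced matrix with the maximally mixed state of the sector. -/
lemma IsInteriorRepresentable.exists_isAdmissible (hN : 1 ≤ N) (hγ : IsDensity γ)
    (hint : IsInteriorRepresentable s N γ) :
    ∃ Γ : ManyBody N d, IsAdmissible s γ Γ ∧
      ∃ c : ℝ, 0 < c ∧ (Γ - c • symProj s N d).PosSemidef := by
  obtain ⟨_, -, Γ₀, hΓ₀⟩ := hint 0 isHermitian_zero (trace_zero _ _)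
  obtain ⟨t, ht, hρ⟩ := hΓ₀.1.exists_smul_symProj
  obtain ⟨m, hm⟩ := exists_hasMarginals hN hρ.2
  have htrace : (γ - m).trace = 0 := by
    rw [trace_sub, hγ.2, ← hm.trace_eq hN, hρ.1.2, sub_self]
  obtain ⟨τ, hτ, Γ', hΓ'⟩ := hint (γ - m) (hγ.1.1.sub (hm.isHermitian hN hρ.1.1.1)) htrace
  have ha : 0 < (1 + τ)⁻¹ := by positivity
  have hab : (1 + τ)⁻¹ + (1 + τ)⁻¹ * τ = 1 := by field_simp
  have hγ' : (1 + τ)⁻¹ • (γ + τ • (γ - m)) + ((1 + τ)⁻¹ * τ) • m = γ := by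
    rw [mul_smul, ← smul_add, smul_sub, add_assoc, sub_add_cancel, smul_add, smul_smul,
      ← add_smul, hab, one_smul]
  have hmix := convex_setOf_isAdmissible s N d (x := (_, Γ')) hΓ'
    (y := (m, t • symProj s N d)) ⟨hρ, hm⟩ ha.le (mul_pos ha hτ).le hab
  refine ⟨(1 + τ)⁻¹ • Γ' + ((1 + τ)⁻¹ * τ) • t • symProj s N d, hγ' ▸ hmix,
    (1 + τ)⁻¹ * τ * t, by positivity, ?_⟩
  rw [smul_smul, add_sub_cancel_right]
  exact hΓ'.1.1.1.smul ha.le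

lemma trace_mul_eq_zero_of_mem_representable (hN : 1 ≤ N) {W : OneBody d}
    (hW : compress s (kroneckerSum N W) = 0) (hγ : γ ∈ representable s N d) :
    (W * γ).trace = 0 := by
  obtain ⟨Γ, hΓ⟩ := hγ
  have hzero : (N : ℂ) * (γ * W).trace = 0 := by
    rw [← hΓ.2.trace_kroneckerSum, Matrix.trace_mul_comm,
      ← trace_compress_mul (isStarProjection_symProj s N d) hΓ.1.2]
    exact (congrArg (fun M => (M * Γ).trace) hW).trans (by rw [Matrix.zero_mul, trace_zero])
  rw [Matrix.trace_mul_comm]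
  exact (mul_eq_zero.1 hzero).resolve_left (Nat.cast_ne_zero.2 (Nat.one_le_iff_ne_zero.1 hN))

/-- Test the vanishing expectations of `W` in the direction `W - (Tr W) γ`. -/
lemma IsInteriorRepresentable.eq_zero_of_compress_kroneckerSum_eq_zero (hN : 1 ≤ N)
    (hγ : IsDensity γ) (hint : IsInteriorRepresentable s N γ) {W : OneBody d} (hW : W.IsHermitian)
    (hzero : compress s (kroneckerSum N W) = 0) : W = 0 := by
  have hexpect {γ' : OneBody d} (h : γ' ∈ representable s N d) : (W * γ').trace = 0 :=
    trace_mul_eq_zero_of_mem_representable hN hzero h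
  have hWγ : (W * γ).trace = 0 := by
    obtain ⟨_, -, h⟩ := hint 0 isHermitian_zero (trace_zero _ _)
    rw [smul_zero, add_zero] at h
    exact hexpect h
  have hself : IsSelfAdjoint W.trace := by
    rw [IsSelfAdjoint, ← trace_conjTranspose, hW.eq]
  obtain ⟨τ, hτ, h⟩ := hint (W - W.trace • γ) (hW.sub (IsHermitian.smul hγ.1.1 hself))
    (by rw [trace_sub, trace_smul, hγ.2, smul_eq_mul, mul_one, sub_self])
  have hWW : τ • (W * W).trace = 0 := by
    simpa [Matrix.mul_add, Matrix.mul_sub, hWγ] using hexpect h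
  rw [smul_eq_zero_iff_right hτ.ne'] at hWW
  exact trace_conjTranspose_mul_self_eq_zero_iff.1 (hW.eq.symm ▸ hWW)

theorem IsInteriorRepresentable.uniqueOptimisers {ε : ℝ} {H : ManyBody N d} (hN : 1 ≤ N)
    (hε : 0 < ε) (hH : H.IsHermitian) (hγ : IsDensity γ) (hint : IsInteriorRepresentable s N γ) :
    UniqueOptimisers s ε H γ := by
  obtain ⟨Γ, hΓ, hfaithful⟩ := hint.exists_isAdmissible hN hγ
  exact uniqueOptimisers_of_isFaithful hN hε hH hγ hΓ hfaithful fun W =>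
    hint.eq_zero_of_compress_kroneckerSum_eq_zero hN hγ

end Interior

end QuantumOT

theorem mainTheorem4_general (N d : ℕ) (hN : 1 ≤ N) (ε : ℝ) (hε : 0 < ε)
    (H : ManyBody N d) (hH : H.IsHermitian) :
    (∀ γ : OneBody d, IsDensity γ → ((N : ℂ)⁻¹ • (1 : OneBody d) - γ).PosSemidef →
      DualityHolds .fermion ε H γ ∧
      (γ.PosDef → ((N : ℂ)⁻¹ • (1 : OneBody d) - γ).PosDef →
        UniqueOptimisers .fermion ε H γ)) ∧
    (∀ γ : OneBody d, IsDensity γ →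
      DualityHolds .boson ε H γ ∧
      (γ.PosDef → UniqueOptimisers .boson ε H γ)) := by
  refine ⟨fun γ hγ hpauli => ⟨?_, fun hpos hstrict => ?_⟩, fun γ hγ => ⟨?_, fun hpos => ?_⟩⟩
  · obtain ⟨Γ, hΓ⟩ := mem_representable_fermion hN hγ hpauli
    exact dualityHolds_of_isAdmissible hN hε hH hγ hΓ
  · exact (isInteriorRepresentable_fermion hN hγ hpos hstrict).uniqueOptimisers hN hε hH hγ
  · obtain ⟨Γ, hΓ⟩ := mem_representable_boson hN hγ
    exact dualityHolds_of_isAdmissible hN hε hH hγ hΓ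
  · exact (isInteriorRepresentable_boson hN hγ hpos).uniqueOptimisers hN hε hH hγ

theorem mainTheorem4 (N d : ℕ) (hN : 1 ≤ N) (ε : ℝ) (hε : 0 < ε)
    (H : ManyBody N d) (hH : H.IsHermitian) (hsym : IsPermSymmetric H) :
    (∀ γ : OneBody d, IsDensity γ → ((N : ℂ)⁻¹ • (1 : OneBody d) - γ).PosSemidef →
      DualityHolds .fermion ε H γ ∧
      (γ.PosDef → ((N : ℂ)⁻¹ • (1 : OneBody d) - γ).PosDef →
        UniqueOptimisers .fermion ε H γ)) ∧
    (∀ γ : OneBody d, IsDensity γ →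
      DualityHolds .boson ε H γ ∧
      (γ.PosDef → UniqueOptimisers .boson ε H γ)) :=
  mainTheorem4_general N d hN ε hε H hH
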